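/- Let $\mathbb{K}$ be an algebraically closed field of characteristic zero, and let $G$ be a finite simple graph with labelled edges $e_1,\dots,e_n$. Write $\mathbb{K}[E(G)]=\mathbb{K}[e_1,\dots,e_n]$, and for a subgraph $H$ of $G$ let $I_H$ be the toric ideal of $H$: the kernel of the homomorphism $\mathbb{K}[E(H)]\to\mathbb{K}[V(H)]$ that sends each edge $\{u,v\}$ to $uv$ (regarded as generating an ideal of $\mathbb{K}[E(G)]$). Let $<_G$ be the lexicographic monomial order with $e_1>e_2>\dots>e_n$. A binomial $e^\alpha-e^\beta\in I_G$ ($\alpha\neq\beta$) is *primitive* if there is no other binomial $e^\gamma-e^\delta\in I_G$ ($\gamma\ne\delta$) with $e^\gamma\mid e^\alpha$ and $e^\delta\mid e^\beta$. Let $\mathcal{U}(I_G)$ be the set of all primitive binomials of $I_G$ of the form $e_{i_1}e_{i_3}\cdots e_{i_{2k-1}}-e_{i_2}e_{i_4}\cdots e_{i_{2k}}$ for a closed even walk $e_{i_1},\dots,e_{i_{2k}}$ in $G$. For disjoint sets $E,F$ of edges with $E\cup F=\{e_1,\dots,e_\ell\}$, $0\le \ell\le n$, put $I^G_{E,F}=I_{G\setminus(E\cup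 F)}+M^G_{E,F}\subseteq\mathbb{K}[E(G)]$, where $G\setminus(E\cup F)$ is $G$ with the edges in $E\cup F$ removed, and $M^G_{E,F}$ is the ideal generated by all monomials $m$ for which there are monomials $q,p$ with $mq-p\in\mathcal{U}(I_G)$ such that (1) $\mathrm{in}_{<_G}(mq-p)=mq$; (2) $q\neq 1$ involves only variables in $E$; (3) no $f\in F$ divides $mq$ and no $e\in E$ divides $m$. A quotient $R/I$ is *equidimensional* if $\dim(R/I)=\dim(R/P)$ for all minimal primes $P$ of $I$, and $I$ is *unmixed* if this holds for all associated primes $P$ of $R/I$. For a variable $y$ of a polynomial ring $R=\mathbb{K}[x_1,\dots,x_r]$ and $f\in R$ of degree $d$ in $y$, the initial $y$-form $\mathrm{in}_y(f)=y^dq$ is the sum of all terms of $f$ in which $y$ has exponent $d$; $\mathrm{in}_y(I)$ is the ideal generated by all $\mathrm{in}_y(f)$, $f\in I$; a monomial order $<$ is $y$-compatible if $\mathrm{in}_<(f)=\mathrm{in}_<(\mathrm{in}_y(f))$ for all $f$. Given a Gröbner basis $g_1,\dots,g_s$ of $I$ for a $y$-compatible order, with $\mathrm{in}_y(g_i)=y^{d_i}q_i$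 where $d_i$ is the degree of $g_i$ in $y$, let $C_{y,I}=\langle q_1,\dots,q_s\rangle$ and $N_{y,I}=\langle q_i\mid d_i=0\rangle$. An ideal $I$ of $R$ is *geometrically vertex decomposable* if $I$ is unmixed and either $I=\langle1\rangle$, or $I$ is generated by a (possibly empty) subset of the variables, or there are a variable $y=x_i$ and a $y$-compatible monomial order with $\mathrm{in}_y(I)=C_{y,I}\cap(N_{y,I}+\langle y\rangle)$ such that the contractions of $C_{y,I}$ and $N_{y,I}$ to $\mathbb{K}[x_1,\dots,\hat{x}_i,\dots,x_r]$ are geometrically vertex decomposable; the ideals $\langle0\rangle$ and $\langle1\rangle$ of $\mathbb{K}$ are geometrically vertex decomposable. **Theorem.** Suppose that $\mathrm{in}_{<_G}(I_G)$ is a square-free monomial ideal. If $\mathbb{K}[E(G)]/I^G_{E,F}$ is equidimensional for every $0\le\ell\le n$ and all disjoint $E,F$ with $E\cup F=\{e_1,\dots,e_\ell\}$, then $I_G\subseteq\mathbb{K}[E(G)]$ is geometrically vertex decomposable. -/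

import Mathlib

open MvPolynomial

noncomputable section

namespace ToricGraph

/-! ### Unmixed and equidimensional ideals -/

section Dimension

variable {R : Type*} [CommRing R]

/-- `I` is unmixed: `dim (R/I) = dim (R/P)` for all associated primes `P` of `R/I`. -/
def IsUnmixed (I : Ideal R) : Prop :=
  ∀ P ∈ associatedPrimes R (R ⧸ I), ringKrullDim (R ⧸ I) = ringKrullDim (R ⧸ P)

/-- `R/I` is equidimensional: `dim (R/I) = dim (R/P)` for all minimal primes `P` of `I`. -/
def IsEquidimensionalQuotient (I : Ideal R) : Prop :=
  ∀ P ∈ I.minimalPrimes, ringKrullDim (R ⧸ I) = ringKrullDim (R ⧸ P)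

end Dimension

/-! ### Initial ideals and Gröbner bases -/

section Groebner

variable {K : Type*} [Field K] {σ : Type*}

/-- The initial ideal of `I` with respect to the monomial order `m`. -/
def initialIdeal (m : MonomialOrder σ) (I : Ideal (MvPolynomial σ K)) :
    Ideal (MvPolynomial σ K) :=
  Ideal.span (m.leadingTerm '' (I : Set (MvPolynomial σ K)))

/-- `B` is a (finite) Gröbner basis of `I` with respect to the monomial order `m`. -/
def IsGroebnerBasis (m : MonomialOrder σ) (B : Finset (MvPolynomial σ K))
    (I : Ideal (MvPolynomial σ K)) : Prop :=
  (∀ g ∈ B, g ∈ I) ∧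
    Ideal.span (m.leadingTerm '' (B : Set (MvPolynomial σ K))) = initialIdeal m I

/-- `I` is a square-free monomial ideal: it is generated by a (possibly empty) set of
square-free monomials. -/
def IsSquarefreeMonomialIdeal (I : Ideal (MvPolynomial σ K)) : Prop :=
  ∃ S : Set (σ →₀ ℕ), (∀ s ∈ S, ∀ i, s i ≤ 1) ∧
    I = Ideal.span ((fun s => monomial s (1 : K)) '' S)

end Groebner

/-! ### Geometric vertex decomposition -/

section GVD

variable {K : Type*} [Field K] {σ : Type*}

/-- Writing `f` as a polynomial in the variable `y`, of degree `d`, with coefficients in the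
other variables, this is the coefficient of `y ^ d`. -/
def topCoeff (y : σ) (f : MvPolynomial σ K) : MvPolynomial σ K :=
  ∑ a ∈ f.support with a y = degreeOf y f, monomial (a.erase y) (coeff a f)

/-- The initial `y`-form of `f`. -/
def initForm (y : σ) (f : MvPolynomial σ K) : MvPolynomial σ K :=
  X y ^ degreeOf y f * topCoeff y f

/-- The ideal generated by the initial `y`-forms of the elements of `I`. -/
def initFormIdeal (y : σ) (I : Ideal (MvPolynomial σ K)) : Ideal (MvPolynomial σ K) :=
  Ideal.span (initForm y '' (I : Set (MvPolynomial σ K)))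

variable (K) in
/-- The monomial order `m` is `y`-compatible: `in_m f = in_m (in_y f)` for all polynomials `f`. -/
def IsCompatible (m : MonomialOrder σ) (y : σ) : Prop :=
  ∀ f : MvPolynomial σ K, m.leadingTerm f = m.leadingTerm (initForm y f)

/-- For a Gröbner basis `B` of `I` with elements `g = y ^ d * q + r`, the ideal `C_{y,I}`
generated by all the `q`. -/
def idealC (y : σ) (B : Finset (MvPolynomial σ K)) : Ideal (MvPolynomial σ K) :=
  Ideal.span {q | ∃ g ∈ B, q = topCoeff y g}

/-- For a Gröbner basis `B` of `I` with elements `g = y ^ d * q + r`, the ideal `N_{y,I}`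
generated by those `q` for which `d = 0`. -/
def idealN (y : σ) (B : Finset (MvPolynomial σ K)) : Ideal (MvPolynomial σ K) :=
  Ideal.span {q | ∃ g ∈ B, degreeOf y g = 0 ∧ q = topCoeff y g}

/-- The contraction of an ideal of `K[x_0, …, x_n]` to the polynomial ring in the variables other
than `x_y` (which are renumbered by `0, …, n-1` in increasing order). -/
def contraction {n : ℕ} (y : Fin (n + 1)) (I : Ideal (MvPolynomial (Fin (n + 1)) K)) :
    Ideal (MvPolynomial (Fin n) K) :=
  I.comap (rename y.succAbove : MvPolynomial (Fin n) K →ₐ[K] MvPolynomial (Fin (n + 1)) K)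

/-- Geometrically vertex decomposable ideals of the polynomial ring in `n` variables. -/
def IsGVD : (n : ℕ) → Ideal (MvPolynomial (Fin n) K) → Prop
  | 0, I => I = ⊥ ∨ I = ⊤
  | n + 1, I =>
    IsUnmixed I ∧
      ((I = ⊤ ∨ ∃ S : Set (Fin (n + 1)), I = Ideal.span (X '' S)) ∨
        ∃ (y : Fin (n + 1)) (m : MonomialOrder.{0, 0} (Fin (n + 1)))
          (B : Finset (MvPolynomial (Fin (n + 1)) K)),
          IsCompatible K m y ∧ IsGroebnerBasis m B I ∧
            initFormIdeal y I = idealC y B ⊓ (idealN y B ⊔ Ideal.span {X y}) ∧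
            IsGVD n (contraction y (idealC y B)) ∧
            IsGVD n (contraction y (idealN y B)))

end GVD

/-! ### Toric ideals of graphs -/

section Toric

variable (K : Type*) [Field K] {V : Type*}

/-- The homomorphism `φ_H : K[E(H)] → K[V(H)]` with `{u, v} ↦ u v`. -/
def edgeHom (H : SimpleGraph V) : MvPolynomial H.edgeSet K →ₐ[K] MvPolynomial V K :=
  aeval fun a => Sym2.mul ((a : Sym2 V).map X)

/-- The toric ideal of the graph `H`, in the polynomial ring on the edges of `H`. -/
def toricIdeal (H : SimpleGraph V) : Ideal (MvPolynomial H.edgeSet K) :=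
  RingHom.ker (edgeHom K H)

variable {G : SimpleGraph V} {n : ℕ} (e : Fin n ≃ G.edgeSet)

/-- Let the edges of `G` be labelled by `0, …, n-1`. For a subgraph `H` of `G`, this is the
ideal generated by the toric ideal of `H` in the polynomial ring `K[E(G)]` on the labels of the
edges of `G`. -/
def toricIdealOfSubgraph (H : SimpleGraph V) (h : H ≤ G) : Ideal (MvPolynomial (Fin n) K) :=
  (toricIdeal K H).map
    (rename (fun a : H.edgeSet => e.symm ⟨a, SimpleGraph.edgeSet_mono h a.2⟩) :
      MvPolynomial H.edgeSet K →ₐ[K] MvPolynomial (Fin n) K)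

/-- The toric ideal `I_G` of the labelled graph `G`, in the polynomial ring on the labels. -/
def labelledToricIdeal : Ideal (MvPolynomial (Fin n) K) :=
  toricIdealOfSubgraph K e G le_rfl

/-- The toric ideal `I_{G \ D}` of the graph `G` with the edges with label in `D` removed,
in the polynomial ring `K[E(G)]`. -/
def deletedToricIdeal (D : Finset (Fin n)) : Ideal (MvPolynomial (Fin n) K) :=
  toricIdealOfSubgraph K e (G.deleteEdges ((fun i => (e i : Sym2 V)) '' (D : Set (Fin n))))
    (G.deleteEdges_le _)

/-- `e^α - e^β` is a primitive binomial of the ideal `I`. -/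
def IsPrimitiveBinomial (I : Ideal (MvPolynomial (Fin n) K)) (α β : Fin n →₀ ℕ) : Prop :=
  (α ≠ β ∧ monomial α (1 : K) - monomial β 1 ∈ I) ∧
    ∀ γ δ : Fin n →₀ ℕ, γ ≠ δ → monomial γ (1 : K) - monomial δ 1 ∈ I →
      γ ≤ α → δ ≤ β → γ = α ∧ δ = β

/-- `f` is the binomial `e_{i_1} e_{i_3} ⋯ e_{i_{2k-1}} - e_{i_2} e_{i_4} ⋯ e_{i_{2k}}` of a closed
even walk `e_{i_1}, …, e_{i_{2k}}` in `G` (positions are counted from `0` below). -/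
def IsClosedEvenWalkBinomial (f : MvPolynomial (Fin n) K) : Prop :=
  ∃ (v : V) (w : G.Walk v v) (k : ℕ) (i : Fin (2 * k) → Fin n),
    w.edges = List.ofFn (fun j => (e (i j) : Sym2 V)) ∧
      f = (∏ j : Fin k, X (i ⟨2 * j, by omega⟩)) - ∏ j : Fin k, X (i ⟨2 * j + 1, by omega⟩)

/-- The universal Gröbner basis `U(I_G)`: the primitive binomials of `I_G` that correspond to
closed even walks in `G`. -/
def universalBasis : Set (MvPolynomial (Fin n) K) :=
  {f | (∃ α β, f = monomial α (1 : K) - monomial β 1 ∧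
      IsPrimitiveBinomial K (labelledToricIdeal K e) α β) ∧
    IsClosedEvenWalkBinomial K e f}

/-- The ideal `M^G_{E,F}`, generated by the monomials `m = e^μ` such that there are monomials
`l = e^lam` and `p = e^π` with `m l - p` in `U(I_G)` such that
(1) the lexicographic initial term of `m l - p` is `m l`;
(2) `l` involves only variables of `E`, and at least one of them;
(3) no variable of `F` divides `m l` and no variable of `E` divides `m`.
In `MonomialOrder.lex` on `Fin n` the variables are ordered by `X 0 > X 1 > ⋯ > X (n-1)`. -/
def monomialIdeal (E F : Finset (Fin n)) : Ideal (MvPolynomial (Fin n) K) :=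
  Ideal.span {f | ∃ μ lam π : Fin n →₀ ℕ, f = monomial μ (1 : K) ∧
    monomial (μ + lam) (1 : K) - monomial π 1 ∈ universalBasis K e ∧
    MonomialOrder.lex.leadingTerm (monomial (μ + lam) (1 : K) - monomial π 1) =
      monomial (μ + lam) 1 ∧
    lam ≠ 0 ∧ lam.support ⊆ E ∧
    (∀ i ∈ F, (μ + lam) i = 0) ∧ (∀ i ∈ E, μ i = 0)}

/-- The ideal `I^G_{E,F} = I_{G \ (E ∪ F)} + M^G_{E,F}`. -/
def idealEF (E F : Finset (Fin n)) : Ideal (MvPolynomial (Fin n) K) :=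
  deletedToricIdeal K e (E ∪ F) ⊔ monomialIdeal K e E F

end Toric

end ToricGraph

end

open ToricGraph

/-! Always decompose with respect to the first variable `X 0`, with the lexicographic order, which
is compatible with it. If the initial ideal of `I` is square-free, then `I` is radical, so
equidimensionality of the quotient upgrades to unmixedness. Moreover `I` has a Gröbner basis of
degree at most one in `X 0`, and this forces `in_y(I) = C ∩ (N + (y))`. The contractions of `C` and
`N` are the ideal of leading coefficients `headIdeal I` and the elimination ideal `contraction 0 I`,
and both again have square-free leading exponents. Hence induction on the number of variables
(`isGVD_of_hasSquarefreeInitial`) needs only the equidimensionality of every ideal obtained by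
iterating these two operations.

It remains to recognise those iterated ideals. Put the label of a variable in `E` when `C` is chosen
and in `F` when `N` is chosen. Unwinding the choices, the elements obtained from `I_G` after `l`
steps are the `f` with `e^a f + r ∈ I_G`, where `a` is supported on `E` and every term of `r` is
smaller than `e^a` already within the first `l` variables (`IsBlockLead`). By `map_shift_eq_idealEF`
this ideal extends to `I^G_{E,F}`. For one inclusion, compare multidegrees in `K[V(G)]`. The
monomials of `f` that, times `e^a`, share a multidegree with a block-smaller monomial lie in
`M^G_{E,F}`, because some primitive binomial divides the relation and primitive binomials come from
closed even walks. The other terms have nothing to cancel against, so their sum lies in the toric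
ideal of the graph with the edges removed. The other inclusion is checked on generators. -/

noncomputable section

namespace ToricGraph

/-! ### The lexicographic order and the first variable. -/

section LexDegree

variable {K : Type*} [Field K] {n : ℕ}

open scoped MonomialOrder

lemma lex_lt_iff_exists {n : ℕ} {a b : Fin n →₀ ℕ} :
    a ≺[MonomialOrder.lex] b ↔ ∃ i, (∀ j < i, a j = b j) ∧ a i < b i := by
  rw [MonomialOrder.lex_lt_iff]; exact Finsupp.Lex.lt_iff

lemma lex_cons_lt_of_lt {n : ℕ} {a b : ℕ} {s t : Fin n →₀ ℕ} (h : a < b) :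
    s.cons a ≺[MonomialOrder.lex] t.cons b :=
  lex_lt_iff_exists.2 ⟨0, fun j hj => absurd hj (Fin.not_lt_zero j), by simpa using h⟩

lemma lex_cons_le_cons {n : ℕ} {a : ℕ} {s t : Fin n →₀ ℕ} (h : s ≼[MonomialOrder.lex] t) :
    s.cons a ≼[MonomialOrder.lex] t.cons a := by
  rcases h.lt_or_eq with h | h
  · obtain ⟨i, hi, hlt⟩ := lex_lt_iff_exists.1 h
    refine (lex_lt_iff_exists.2 ⟨i.succ, fun j hj => ?_, by simpa using hlt⟩).le
    cases j using Fin.cases with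
    | zero => simp
    | succ j => simpa using hi j (by simpa using hj)
  · rw [MonomialOrder.lex.toSyn.injective h]

/-- The leading coefficient with respect to the variable `X 0`, as a polynomial in the other
variables. -/
def headCoeff (f : MvPolynomial (Fin (n + 1)) K) : MvPolynomial (Fin n) K :=
  (finSuccEquiv K n f).leadingCoeff

lemma headCoeff_ne_zero {f : MvPolynomial (Fin (n + 1)) K} (hf : f ≠ 0) : headCoeff f ≠ 0 := by
  simpa [headCoeff] using hf

@[simp] lemma headCoeff_zero : headCoeff (0 : MvPolynomial (Fin (n + 1)) K) = 0 := by
  simp [headCoeff]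

/-- The lexicographic degree of `f` is the degree in `X 0` followed by the degree of the
leading coefficient. -/
lemma lex_degree_eq_cons {f : MvPolynomial (Fin (n + 1)) K} (hf : f ≠ 0) :
    MonomialOrder.lex.degree f =
      (MonomialOrder.lex.degree (headCoeff f)).cons (degreeOf 0 f) := by
  have hq := headCoeff_ne_zero hf
  apply MonomialOrder.lex.toSyn.injective
  apply le_antisymm
  · rw [MonomialOrder.degree_le_iff]
    intro b hb
    rw [← Finsupp.cons_tail b]
    have hb0 : b 0 ≤ degreeOf 0 f := by
      rw [degreeOf_eq_sup]; exact Finset.le_sup (f := fun b => b 0) hb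
    rcases hb0.lt_or_eq with h | h
    · exact (lex_cons_lt_of_lt h).le
    · rw [h]
      refine lex_cons_le_cons (MonomialOrder.le_degree ?_)
      rw [headCoeff, Polynomial.leadingCoeff, natDegree_finSuccEquiv,
        mem_support_coeff_finSuccEquiv, ← h, Finsupp.cons_tail]
      exact hb
  · apply MonomialOrder.le_degree
    rw [← mem_support_coeff_finSuccEquiv, ← natDegree_finSuccEquiv]
    exact MonomialOrder.degree_mem_support hq

lemma lex_leadingCoeff_eq (f : MvPolynomial (Fin (n + 1)) K) :
    MonomialOrder.lex.leadingCoeff f = MonomialOrder.lex.leadingCoeff (headCoeff f) := by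
  by_cases hf : f = 0
  · simp [hf]
  · rw [MonomialOrder.leadingCoeff, MonomialOrder.leadingCoeff, lex_degree_eq_cons hf,
      ← finSuccEquiv_coeff_coeff, ← natDegree_finSuccEquiv]
    rfl

lemma finSuccEquiv_rename_succ (p : MvPolynomial (Fin n) K) :
    finSuccEquiv K n (rename Fin.succ p) = Polynomial.C p := by
  induction p using MvPolynomial.induction_on with
  | C a => simp [finSuccEquiv_apply]
  | add p q hp hq => simp [hp, hq]
  | mul_X p i hp => simp [hp, finSuccEquiv_X_succ]

lemma topCoeff_zero_eq (f : MvPolynomial (Fin (n + 1)) K) :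
    topCoeff 0 f = rename Fin.succ (headCoeff f) := by
  classical
  apply (finSuccEquiv K n).injective
  rw [finSuccEquiv_rename_succ]
  ext i c
  rw [finSuccEquiv_coeff_coeff, topCoeff, coeff_sum, Polynomial.coeff_C]
  simp only [coeff_monomial]
  have key : ∀ a : Fin (n + 1) →₀ ℕ, a.erase 0 = c.cons i ↔ i = 0 ∧ a = c.cons (a 0) := by
    intro a
    constructor
    · intro h
      have h0 : i = 0 := by simpa using (DFunLike.congr_fun h 0).symm
      refine ⟨h0, ?_⟩
      ext j
      cases j using Fin.cases with
      | zero => simp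
      | succ j => simpa using DFunLike.congr_fun h j.succ
    · rintro ⟨rfl, h⟩
      ext j
      cases j using Fin.cases with
      | zero => simp
      | succ j => simpa using DFunLike.congr_fun h j.succ
  split_ifs with hi
  · subst hi
    rw [headCoeff, Polynomial.leadingCoeff, natDegree_finSuccEquiv, finSuccEquiv_coeff_coeff]
    rw [Finset.sum_eq_single (c.cons (degreeOf 0 f))]
    · rw [if_pos ((key _).2 ⟨rfl, by simp⟩)]
    · intro b hb hne
      rw [if_neg]
      intro h
      apply hne
      rw [((key _).1 h).2, (Finset.mem_filter.1 hb).2]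
    · intro h
      by_cases h' : c.cons (degreeOf 0 f) ∈ f.support
      · exact absurd (Finset.mem_filter.2 ⟨h', by simp⟩) h
      · rw [notMem_support_iff.1 h', ite_self]
  · rw [coeff_zero]
    refine Finset.sum_eq_zero fun a _ => if_neg fun h => hi ((key a).1 h).1

lemma finSuccEquiv_initForm_zero (f : MvPolynomial (Fin (n + 1)) K) :
    finSuccEquiv K n (initForm 0 f) =
      Polynomial.C (headCoeff f) * Polynomial.X ^ degreeOf 0 f := by
  rw [initForm, topCoeff_zero_eq, map_mul, map_pow, finSuccEquiv_X_zero,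
    finSuccEquiv_rename_succ, mul_comm]

lemma headCoeff_initForm (f : MvPolynomial (Fin (n + 1)) K) :
    headCoeff (initForm 0 f) = headCoeff f := by
  rw [headCoeff, finSuccEquiv_initForm_zero]
  simp

lemma degreeOf_initForm (f : MvPolynomial (Fin (n + 1)) K) :
    degreeOf 0 (initForm 0 f) = degreeOf 0 f := by
  by_cases hf : f = 0
  · simp [hf, initForm, topCoeff]
  rw [← natDegree_finSuccEquiv, finSuccEquiv_initForm_zero,
    Polynomial.natDegree_C_mul_X_pow _ _ (headCoeff_ne_zero hf)]

/-- The leading term depends only on the degree in `X 0` and on the head coefficient, and `initForm`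
preserves both. -/
lemma isCompatible_lex_zero :
    IsCompatible K (MonomialOrder.lex : MonomialOrder (Fin (n + 1))) 0 := by
  intro f
  by_cases hf : f = 0
  · simp [hf, initForm, topCoeff]
  have hf' : initForm 0 f ≠ 0 := by
    intro h
    have := headCoeff_initForm f
    rw [h, headCoeff_zero] at this
    exact headCoeff_ne_zero hf this.symm
  rw [MonomialOrder.leadingTerm, MonomialOrder.leadingTerm, lex_degree_eq_cons hf,
    lex_degree_eq_cons hf', lex_leadingCoeff_eq f, lex_leadingCoeff_eq (initForm 0 f),
    headCoeff_initForm, degreeOf_initForm]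

end LexDegree

/-! ### Ideals with square-free leading exponents. -/

section Groebner

variable {K : Type*} [Field K] {σ : Type*} (m : MonomialOrder σ)

/-- An ideal contained in another one with no fewer leading exponents (up to divisibility)
coincides with it. -/
lemma le_of_forall_degree_le {I J : Ideal (MvPolynomial σ K)} (hIJ : I ≤ J)
    (h : ∀ f ∈ J, f ≠ 0 → ∃ g ∈ I, g ≠ 0 ∧ m.degree g ≤ m.degree f) : J ≤ I := by
  intro f
  induction hd : m.toSyn (m.degree f) using WellFoundedLT.induction generalizing f with
  | ind d ih =>
    subst hd
    intro hf
    by_cases hf0 : f = 0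
    · simp [hf0]
    obtain ⟨g, hg, hg0, hle⟩ := h f hf hf0
    set c := m.leadingCoeff f / m.leadingCoeff g with hc
    have hgc : m.leadingCoeff g ≠ 0 := by simpa using hg0
    have hfc : m.leadingCoeff f ≠ 0 := by simpa using hf0
    have hc0 : c ≠ 0 := div_ne_zero hfc hgc
    -- `t` is the multiple of `g` with the same leading term as `f`, so `f - t` is zero or of
    -- smaller degree.
    set t := monomial (m.degree f - m.degree g) c * g with ht
    have htI : t ∈ I := I.mul_mem_left _ hg
    have hmon0 : monomial (m.degree f - m.degree g) c ≠ 0 := by simpa using hc0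
    classical
    have htd : m.degree t = m.degree f := by
      rw [ht, MonomialOrder.degree_mul hmon0 hg0, MonomialOrder.degree_monomial, if_neg hc0,
        tsub_add_cancel_of_le hle]
    have htc : m.leadingCoeff t = m.leadingCoeff f := by
      rw [ht, MonomialOrder.leadingCoeff_mul, MonomialOrder.leadingCoeff_monomial, hc,
        div_mul_cancel₀ _ hgc]
    have hsub : f - t ∈ I := by
      by_cases hz : f - t = 0
      · rw [hz]; exact I.zero_mem
      refine ih _ ?_ rfl (J.sub_mem hf (hIJ htI))
      have hle' : m.toSyn (m.degree (f - t)) ≤ m.toSyn (m.degree f) := by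
        refine m.degree_sub_le.trans ?_
        rw [htd, sup_idem]
      refine lt_of_le_of_ne hle' fun heq => ?_
      have h1 := m.toSyn.injective heq
      have h2 : (f - t).coeff (m.degree (f - t)) ≠ 0 := by
        rw [MonomialOrder.coeff_degree_ne_zero_iff]; exact hz
      rw [h1, coeff_sub] at h2
      apply h2
      rw [MonomialOrder.leadingCoeff, MonomialOrder.leadingCoeff, htd] at htc
      rw [htc, sub_self]
    simpa using I.add_mem hsub htI

/-- Every leading exponent of `I` is divisible by a square-free leading exponent of `I`. -/
def HasSquarefreeInitial (I : Ideal (MvPolynomial σ K)) : Prop :=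
  ∀ f ∈ I, f ≠ 0 → ∃ g ∈ I, g ≠ 0 ∧ m.degree g ≤ m.degree f ∧ ∀ i, m.degree g i ≤ 1

variable {m}

lemma span_leadingTerm_eq_span_monomial (A : Set (MvPolynomial σ K)) :
    Ideal.span (m.leadingTerm '' A) =
      Ideal.span ((fun s => monomial s (1 : K)) '' (m.degree '' {g ∈ A | g ≠ 0})) := by
  apply le_antisymm
  · rw [Ideal.span_le]
    rintro _ ⟨f, hf, rfl⟩
    by_cases hf0 : f = 0
    · simp [hf0]
    have : m.leadingTerm f = C (m.leadingCoeff f) * monomial (m.degree f) 1 := by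
      simp [MonomialOrder.leadingTerm, C_mul_monomial]
    rw [this]
    exact Ideal.mul_mem_left _ _ (Ideal.subset_span ⟨_, ⟨f, ⟨hf, hf0⟩, rfl⟩, rfl⟩)
  · rw [Ideal.span_le]
    rintro _ ⟨_, ⟨f, ⟨hf, hf0⟩, rfl⟩, rfl⟩
    have hc : m.leadingCoeff f ≠ 0 := by simpa using hf0
    have : monomial (m.degree f) 1 = C (m.leadingCoeff f)⁻¹ * m.leadingTerm f := by
      simp [MonomialOrder.leadingTerm, C_mul_monomial, hc]
    simp only [this]
    exact Ideal.mul_mem_left _ _ (Ideal.subset_span ⟨f, hf, rfl⟩)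

/-- The leading exponent of `f` is divisible by some `s ∈ S`, and `s` in turn by the leading
exponent of some `g ∈ I`. The latter divides a square-free exponent, so it is square-free. -/
lemma hasSquarefreeInitial_of_initialIdeal {I : Ideal (MvPolynomial σ K)}
    (h : IsSquarefreeMonomialIdeal (initialIdeal m I)) : HasSquarefreeInitial m I := by
  classical
  obtain ⟨S, hS, hI⟩ := h
  rw [initialIdeal, span_leadingTerm_eq_span_monomial] at hI
  intro f hf hf0
  have h1 : monomial (m.degree f) (1 : K) ∈ Ideal.span ((fun s => monomial s (1 : K)) '' S) := by
    rw [← hI]; exact Ideal.subset_span ⟨_, ⟨f, ⟨hf, hf0⟩, rfl⟩, rfl⟩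
  obtain ⟨s, hs, hle⟩ := mem_ideal_span_monomial_image.1 h1 (m.degree f) (by simp)
  have h2 : monomial s (1 : K) ∈
      Ideal.span ((fun s => monomial s (1 : K)) '' (m.degree '' {g ∈ (I : Set (MvPolynomial σ K)) | g ≠ 0})) := by
    rw [hI]; exact Ideal.subset_span ⟨s, hs, rfl⟩
  obtain ⟨_, ⟨g, ⟨hg, hg0⟩, rfl⟩, hle'⟩ := mem_ideal_span_monomial_image.1 h2 s (by simp)
  exact ⟨g, hg, hg0, hle'.trans hle, fun i => (hle' i).trans (hS s hs i)⟩

/-- A square-free exponent dividing `k` times the leading exponent of `f` already divides that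
exponent. Thus the radical has no leading exponents beyond those of `I`. -/
lemma HasSquarefreeInitial.isRadical {I : Ideal (MvPolynomial σ K)}
    (h : HasSquarefreeInitial m I) : I.IsRadical := by
  refine le_of_forall_degree_le (I := I) m Ideal.le_radical ?_
  rintro f ⟨k, hk⟩ hf0
  obtain ⟨g, hg, hg0, hle, hsq⟩ := h _ hk (pow_ne_zero k hf0)
  refine ⟨g, hg, hg0, fun i => ?_⟩
  have h1 := hle i
  rw [MonomialOrder.degree_pow] at h1
  have h2 := hsq i
  rcases Nat.eq_zero_or_pos (m.degree f i) with h0 | h0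
  · simp [h0] at h1
    omega
  · omega

/-- A Gröbner basis with square-free leading exponents. -/
lemma HasSquarefreeInitial.exists_basis [Finite σ] {I : Ideal (MvPolynomial σ K)}
    (h : HasSquarefreeInitial m I) :
    ∃ B : Finset (MvPolynomial σ K), IsGroebnerBasis m B I ∧
      (∀ g ∈ B, ∀ i, m.degree g i ≤ 1) ∧
      ∀ f ∈ I, f ≠ 0 → ∃ g ∈ B, g ≠ 0 ∧ m.degree g ≤ m.degree f := by
  classical
  cases nonempty_fintype σ
  -- There are finitely many square-free exponents in finitely many variables. The basis takes one
  -- element of `I` for each that occurs.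
  let D : Set (σ →₀ ℕ) := {d | (∀ i, d i ≤ 1) ∧ ∃ g ∈ I, g ≠ 0 ∧ m.degree g = d}
  have hD : D.Finite := by
    refine (Set.finite_Iic (Finsupp.equivFunOnFinite.symm fun _ => 1)).subset ?_
    intro d hd i
    simpa using hd.1 i
  have hch : ∀ d : σ →₀ ℕ, ∃ g : MvPolynomial σ K, d ∈ D → g ∈ I ∧ g ≠ 0 ∧ m.degree g = d := by
    intro d
    by_cases hd : d ∈ D
    · obtain ⟨g, hg⟩ := hd.2
      exact ⟨g, fun _ => hg⟩
    · exact ⟨0, fun h => absurd h hd⟩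
  choose γ hγ using hch
  have hdiv : ∀ f ∈ I, f ≠ 0 → ∃ g ∈ hD.toFinset.image γ, g ≠ 0 ∧ m.degree g ≤ m.degree f := by
    intro f hf hf0
    obtain ⟨g, hg, hg0, hle, hsq⟩ := h f hf hf0
    have hgD : m.degree g ∈ D := ⟨hsq, g, hg, hg0, rfl⟩
    obtain ⟨h1, h2, h3⟩ := hγ _ hgD
    exact ⟨γ (m.degree g), Finset.mem_image_of_mem _ (hD.mem_toFinset.2 hgD), h2,
      h3.le.trans hle⟩
  have hBI : ∀ g ∈ hD.toFinset.image γ, g ∈ I := by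
    intro g hg
    obtain ⟨d, hd, rfl⟩ := Finset.mem_image.1 hg
    exact (hγ d (hD.mem_toFinset.1 hd)).1
  refine ⟨hD.toFinset.image γ, ⟨hBI, ?_⟩, ?_, hdiv⟩
  · apply le_antisymm
    · exact Ideal.span_mono (Set.image_mono fun g hg => hBI g hg)
    · rw [initialIdeal, span_leadingTerm_eq_span_monomial, span_leadingTerm_eq_span_monomial,
        Ideal.span_le]
      rintro _ ⟨_, ⟨f, ⟨hf, hf0⟩, rfl⟩, rfl⟩
      obtain ⟨g, hg, hg0, hle⟩ := hdiv f hf hf0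
      have : monomial (m.degree f) (1 : K) =
          monomial (m.degree f - m.degree g) 1 * monomial (m.degree g) 1 := by
        rw [monomial_mul, tsub_add_cancel_of_le hle, mul_one]
      simp only [this]
      exact Ideal.mul_mem_left _ _ (Ideal.subset_span ⟨_, ⟨g, ⟨hg, hg0⟩, rfl⟩, rfl⟩)
  · intro g hg
    obtain ⟨d, hd, rfl⟩ := Finset.mem_image.1 hg
    have hd' := hD.mem_toFinset.1 hd
    rw [(hγ d hd').2.2]
    exact hd'.1

end Groebner

/-! ### From equidimensional to unmixed for radical ideals. -/

section Unmixed

variable {R : Type*} [CommRing R]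

/-- Associated primes of a radical ideal are minimal: `P = (I : x)` with `x ∉ P`, so a prime `Q ⊆ P`
over `I` contains `a x` but not `x`, hence contains every `a ∈ P`. -/
lemma isUnmixed_of_isRadical {I : Ideal R} (hI : I.IsRadical)
    (h : IsEquidimensionalQuotient I) : IsUnmixed I := by
  intro P hP
  apply h
  obtain ⟨hp, x, hx⟩ := hP
  obtain ⟨x, rfl⟩ := Ideal.Quotient.mk_surjective x
  have hmem : ∀ a, a ∈ P ↔ a * x ∈ I := by
    intro a
    have key : ∀ b, b ∈ (⊥ : Submodule R (R ⧸ I)).colon {Ideal.Quotient.mk I x} ↔ b * x ∈ I := by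
      intro b
      rw [Submodule.mem_colon_singleton, Submodule.mem_bot, Algebra.smul_def,
        Ideal.Quotient.algebraMap_eq, ← map_mul, Ideal.Quotient.eq_zero_iff_mem]
    rw [hx]
    constructor
    · rintro ⟨k, hk⟩
      -- An associated prime is here the radical of a colon ideal. From `a ^ k * x ∈ I` follows `(a
      -- * x) ^ (k + 1) ∈ I`; the exponent `k + 1` also covers `k = 0`.
      refine hI ⟨k + 1, ?_⟩
      have h1 := I.mul_mem_right (a * x ^ k) ((key _).1 hk)
      convert h1 using 1
      ring
    · exact fun ha => Ideal.le_radical ((key _).2 ha)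
  have hxP : x ∉ P := fun hxP => by
    have h1 : x ∈ I := hI ⟨2, by simpa [sq] using (hmem x).1 hxP⟩
    exact hp.ne_top ((Ideal.eq_top_iff_one _).2 ((hmem 1).2 (by simpa using h1)))
  refine ⟨⟨hp, fun i hi => (hmem i).2 (I.mul_mem_right _ hi)⟩, ?_⟩
  rintro Q ⟨hQ, hIQ⟩ hQP a ha
  exact (hQ.mem_or_mem (hIQ ((hmem a).1 ha))).resolve_right fun h => hxP (hQP h)

end Unmixed

/-! ### One step of the decomposition, and the induction. -/

section Step

variable {K : Type*} [Field K] {n : ℕ}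

/-- The ideal of leading coefficients, with respect to `X 0`, of the elements of `I`. -/
def headIdeal (I : Ideal (MvPolynomial (Fin (n + 1)) K)) : Ideal (MvPolynomial (Fin n) K) :=
  (I.comap (finSuccEquiv K n).symm.toRingHom).leadingCoeff

lemma mem_headIdeal {I : Ideal (MvPolynomial (Fin (n + 1)) K)} {q : MvPolynomial (Fin n) K} :
    q ∈ headIdeal I ↔ ∃ f ∈ I, headCoeff f = q := by
  rw [headIdeal, Ideal.mem_leadingCoeff]
  constructor
  · rintro ⟨p, hp, rfl⟩
    exact ⟨(finSuccEquiv K n).symm p, hp, by simp [headCoeff]⟩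
  · rintro ⟨f, hf, rfl⟩
    exact ⟨finSuccEquiv K n f, by simpa using hf, rfl⟩

lemma mem_contraction_zero {I : Ideal (MvPolynomial (Fin (n + 1)) K)}
    {q : MvPolynomial (Fin n) K} : q ∈ contraction 0 I ↔ rename Fin.succ q ∈ I := by
  rw [contraction, Ideal.mem_comap, Fin.succAbove_zero]

/-- The extension of an ideal to the polynomial ring with the new variable `X 0`. -/
def succExtension (J : Ideal (MvPolynomial (Fin n) K)) : Ideal (MvPolynomial (Fin (n + 1)) K) :=
  J.map (rename Fin.succ : MvPolynomial (Fin n) K →ₐ[K] MvPolynomial (Fin (n + 1)) K)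

lemma succExtension_eq_comap (J : Ideal (MvPolynomial (Fin n) K)) :
    succExtension J = (J.map (Polynomial.C : _ →+* Polynomial (MvPolynomial (Fin n) K))).comap
      (finSuccEquiv K n) := by
  apply le_antisymm
  · rw [succExtension, Ideal.map_le_iff_le_comap]
    intro p hp
    rw [Ideal.mem_comap, Ideal.mem_comap, finSuccEquiv_rename_succ]
    exact Ideal.mem_map_of_mem _ hp
  · have h : (J.map (Polynomial.C : _ →+* Polynomial (MvPolynomial (Fin n) K))) ≤
        (succExtension J).comap (finSuccEquiv K n).symm := by
      rw [Ideal.map_le_iff_le_comap]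
      intro p hp
      rw [Ideal.mem_comap, Ideal.mem_comap, ← finSuccEquiv_rename_succ, AlgEquiv.symm_apply_apply]
      exact Ideal.mem_map_of_mem _ hp
    intro f hf
    simpa using h hf

lemma mem_succExtension {J : Ideal (MvPolynomial (Fin n) K)} {f : MvPolynomial (Fin (n + 1)) K} :
    f ∈ succExtension J ↔ ∀ i, (finSuccEquiv K n f).coeff i ∈ J := by
  rw [succExtension_eq_comap, Ideal.mem_comap]
  exact Ideal.mem_map_C_iff

lemma rename_succ_mem_succExtension {J : Ideal (MvPolynomial (Fin n) K)}
    {q : MvPolynomial (Fin n) K} : rename Fin.succ q ∈ succExtension J ↔ q ∈ J := by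
  rw [succExtension_eq_comap, Ideal.mem_comap, finSuccEquiv_rename_succ]
  constructor
  · intro h
    simpa using Ideal.mem_map_C_iff.1 h 0
  · exact fun h => Ideal.mem_map_of_mem _ h

lemma contraction_succExtension (J : Ideal (MvPolynomial (Fin n) K)) :
    contraction 0 (succExtension J) = J := by
  ext q
  rw [mem_contraction_zero, rename_succ_mem_succExtension]

lemma headCoeff_rename_succ (q : MvPolynomial (Fin n) K) : headCoeff (rename Fin.succ q) = q := by
  rw [headCoeff, finSuccEquiv_rename_succ, Polynomial.leadingCoeff_C]

lemma degreeOf_rename_succ (q : MvPolynomial (Fin n) K) :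
    degreeOf 0 (rename Fin.succ q) = 0 := by
  rw [← natDegree_finSuccEquiv, finSuccEquiv_rename_succ, Polynomial.natDegree_C]

lemma rename_succ_headCoeff {f : MvPolynomial (Fin (n + 1)) K} (hf : degreeOf 0 f = 0) :
    rename Fin.succ (headCoeff f) = f := by
  rw [← natDegree_finSuccEquiv] at hf
  apply (finSuccEquiv K n).injective
  rw [finSuccEquiv_rename_succ, headCoeff, Polynomial.leadingCoeff, hf]
  exact (Polynomial.eq_C_of_natDegree_eq_zero hf).symm

lemma contraction_le_headIdeal (I : Ideal (MvPolynomial (Fin (n + 1)) K)) :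
    contraction 0 I ≤ headIdeal I := fun q hq =>
  mem_headIdeal.2 ⟨_, mem_contraction_zero.1 hq, headCoeff_rename_succ q⟩

lemma degree_headCoeff_le {f g : MvPolynomial (Fin (n + 1)) K} (hf : f ≠ 0) (hg : g ≠ 0)
    (h : MonomialOrder.lex.degree g ≤ MonomialOrder.lex.degree f) :
    degreeOf 0 g ≤ degreeOf 0 f ∧
      MonomialOrder.lex.degree (headCoeff g) ≤ MonomialOrder.lex.degree (headCoeff f) := by
  rw [lex_degree_eq_cons hf, lex_degree_eq_cons hg] at h
  exact ⟨by simpa using h 0, fun i => by simpa using h i.succ⟩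

lemma HasSquarefreeInitial.headIdeal {I : Ideal (MvPolynomial (Fin (n + 1)) K)}
    (h : HasSquarefreeInitial MonomialOrder.lex I) :
    HasSquarefreeInitial MonomialOrder.lex (headIdeal I) := by
  intro q hq hq0
  obtain ⟨f, hf, rfl⟩ := mem_headIdeal.1 hq
  have hf0 : f ≠ 0 := by rintro rfl; simp at hq0
  obtain ⟨g, hg, hg0, hle, hsq⟩ := h f hf hf0
  refine ⟨headCoeff g, mem_headIdeal.2 ⟨g, hg, rfl⟩, headCoeff_ne_zero hg0,
    (degree_headCoeff_le hf0 hg0 hle).2, fun i => ?_⟩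
  rw [lex_degree_eq_cons hg0] at hsq
  simpa using hsq i.succ

/-- Elimination property of the lexicographic order: if the leading exponent of `g` divides one not
involving `X 0`, then `g` itself does not involve `X 0`. -/
lemma HasSquarefreeInitial.contraction {I : Ideal (MvPolynomial (Fin (n + 1)) K)}
    (h : HasSquarefreeInitial MonomialOrder.lex I) :
    HasSquarefreeInitial MonomialOrder.lex (contraction 0 I) := by
  intro q hq hq0
  have hf0 : rename Fin.succ q ≠ 0 := fun h0 =>
    hq0 (rename_injective _ (Fin.succ_injective n) (h0.trans (map_zero _).symm))
  obtain ⟨g, hg, hg0, hle, hsq⟩ := h _ (mem_contraction_zero.1 hq) hf0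
  have hd := degree_headCoeff_le hf0 hg0 hle
  rw [degreeOf_rename_succ, headCoeff_rename_succ] at hd
  refine ⟨headCoeff g, mem_contraction_zero.2 ?_, headCoeff_ne_zero hg0, hd.2, fun i => ?_⟩
  · rwa [rename_succ_headCoeff (Nat.le_zero.1 hd.1)]
  · rw [lex_degree_eq_cons hg0] at hsq
    simpa using hsq i.succ

variable {I : Ideal (MvPolynomial (Fin (n + 1)) K)} {B : Finset (MvPolynomial (Fin (n + 1)) K)}

/-- Head coefficients of the basis generate `headIdeal I`, since their leading exponents divide all
those of `headIdeal I`. So `C` does not depend on `B`. -/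
lemma idealC_eq_succExtension (hBI : ∀ g ∈ B, g ∈ I)
    (hB : ∀ f ∈ I, f ≠ 0 → ∃ g ∈ B, g ≠ 0 ∧
      MonomialOrder.lex.degree g ≤ MonomialOrder.lex.degree f) :
    idealC 0 B = succExtension (headIdeal I) := by
  have hspan : headIdeal I = Ideal.span (headCoeff '' (B : Set (MvPolynomial (Fin (n + 1)) K))) := by
    have hle : Ideal.span (headCoeff '' (B : Set (MvPolynomial (Fin (n + 1)) K))) ≤
        headIdeal I := by
      rw [Ideal.span_le]
      rintro _ ⟨g, hg, rfl⟩
      exact mem_headIdeal.2 ⟨g, hBI g hg, rfl⟩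
    refine le_antisymm (le_of_forall_degree_le MonomialOrder.lex hle ?_) hle
    intro q hq hq0
    obtain ⟨f, hf, rfl⟩ := mem_headIdeal.1 hq
    have hf0 : f ≠ 0 := by rintro rfl; simp at hq0
    obtain ⟨g, hg, hg0, hle⟩ := hB f hf hf0
    exact ⟨headCoeff g, Ideal.subset_span ⟨g, hg, rfl⟩, headCoeff_ne_zero hg0,
      (degree_headCoeff_le hf0 hg0 hle).2⟩
  rw [hspan, succExtension, Ideal.map_span, idealC]
  congr 1
  ext q
  simp only [topCoeff_zero_eq, Set.mem_image, exists_exists_and_eq_and, Set.mem_ofPred_eq]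
  exact ⟨fun ⟨g, hg, h⟩ => ⟨g, hg, h.symm⟩, fun ⟨g, hg, h⟩ => ⟨g, hg, h.symm⟩⟩

lemma idealN_eq_succExtension (hBI : ∀ g ∈ B, g ∈ I)
    (hB : ∀ f ∈ I, f ≠ 0 → ∃ g ∈ B, g ≠ 0 ∧
      MonomialOrder.lex.degree g ≤ MonomialOrder.lex.degree f) :
    idealN 0 B = succExtension (contraction 0 I) := by
  have hspan : contraction 0 I = Ideal.span (headCoeff '' {g | g ∈ B ∧ degreeOf 0 g = 0}) := by
    have hle : Ideal.span (headCoeff '' {g | g ∈ B ∧ degreeOf 0 g = 0}) ≤ contraction 0 I := by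
      rw [Ideal.span_le]
      rintro _ ⟨g, ⟨hg, hg0⟩, rfl⟩
      rw [SetLike.mem_coe, mem_contraction_zero, rename_succ_headCoeff hg0]
      exact hBI g hg
    refine le_antisymm (le_of_forall_degree_le MonomialOrder.lex hle ?_) hle
    intro q hq hq0
    have hf0 : rename Fin.succ q ≠ 0 := fun h0 =>
      hq0 (rename_injective _ (Fin.succ_injective n) (h0.trans (map_zero _).symm))
    obtain ⟨g, hg, hg0, hle⟩ := hB _ (mem_contraction_zero.1 hq) hf0
    have hd := degree_headCoeff_le hf0 hg0 hle
    rw [degreeOf_rename_succ, headCoeff_rename_succ] at hd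
    exact ⟨headCoeff g, Ideal.subset_span ⟨g, ⟨hg, Nat.le_zero.1 hd.1⟩, rfl⟩,
      headCoeff_ne_zero hg0, hd.2⟩
  rw [hspan, succExtension, Ideal.map_span, idealN]
  congr 1
  ext q
  simp only [topCoeff_zero_eq, Set.mem_image, exists_exists_and_eq_and, Set.mem_ofPred_eq]
  exact ⟨fun ⟨g, hg, h0, h⟩ => ⟨g, ⟨hg, h0⟩, h.symm⟩, fun ⟨g, ⟨hg, h0⟩, h⟩ => ⟨g, hg, h0, h.symm⟩⟩

/-- The degree bound enters here: for a basis element of degree one `X 0 * q` is its initial form,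
and for degree zero it is a multiple of it. -/
lemma X_mul_mem_initFormIdeal (hBI : ∀ g ∈ B, g ∈ I) (hsq : ∀ g ∈ B, degreeOf 0 g ≤ 1)
    {f : MvPolynomial (Fin (n + 1)) K} (hf : f ∈ idealC 0 B) :
    X 0 * f ∈ initFormIdeal 0 I := by
  induction hf using Submodule.span_induction with
  | mem q hq =>
    obtain ⟨g, hg, rfl⟩ := hq
    have hmem : initForm 0 g ∈ initFormIdeal 0 I := Ideal.subset_span ⟨g, hBI g hg, rfl⟩
    have hd := hsq g hg
    rw [initForm] at hmem
    interval_cases h : degreeOf 0 g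
    · exact Ideal.mul_mem_left _ _ (by simpa using hmem)
    · simpa using hmem
  | zero => simp
  | add p q _ _ hp hq => rw [mul_add]; exact Ideal.add_mem _ hp hq
  | smul a p _ hp =>
    rw [smul_eq_mul, mul_left_comm]
    exact Ideal.mul_mem_left _ _ hp

lemma initFormIdeal_eq (hBI : ∀ g ∈ B, g ∈ I) (hsq : ∀ g ∈ B, degreeOf 0 g ≤ 1)
    (hB : ∀ f ∈ I, f ≠ 0 → ∃ g ∈ B, g ≠ 0 ∧
      MonomialOrder.lex.degree g ≤ MonomialOrder.lex.degree f) :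
    initFormIdeal 0 I = idealC 0 B ⊓ (idealN 0 B ⊔ Ideal.span {X 0}) := by
  apply le_antisymm
  · rw [initFormIdeal, Ideal.span_le]
    rintro _ ⟨f, hf, rfl⟩
    refine ⟨?_, ?_⟩
    · rw [SetLike.mem_coe, idealC_eq_succExtension hBI hB, initForm, topCoeff_zero_eq]
      exact Ideal.mul_mem_left _ _
        (rename_succ_mem_succExtension.2 (mem_headIdeal.2 ⟨f, hf, rfl⟩))
    · rcases Nat.eq_zero_or_pos (degreeOf 0 f) with h0 | h0
      · refine Ideal.mem_sup_left ?_
        rw [idealN_eq_succExtension hBI hB, initForm, topCoeff_zero_eq]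
        refine Ideal.mul_mem_left _ _ (rename_succ_mem_succExtension.2 (mem_contraction_zero.2 ?_))
        rwa [rename_succ_headCoeff h0]
      · refine Ideal.mem_sup_right (Ideal.mul_mem_right _ _ ?_)
        exact Ideal.pow_mem_of_mem _ (Ideal.mem_span_singleton_self _) _ h0
  · rintro h ⟨hC, hN⟩
    obtain ⟨u, hu, w, hw, rfl⟩ := Submodule.mem_sup.1 hN
    obtain ⟨v, rfl⟩ := Ideal.mem_span_singleton'.1 hw
    rw [idealN_eq_succExtension hBI hB] at hu
    have hC' : u + v * X 0 ∈ succExtension (headIdeal I) :=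
      (idealC_eq_succExtension hBI hB).le hC
    -- Since `N ⊆ C`, both `u` and `u + v * X 0` have their coefficients in `headIdeal I`. Comparing
    -- at `X 0 ^ (i + 1)` puts those of `v` there too.
    have hcoeff : ∀ i, (finSuccEquiv K n v).coeff i ∈ headIdeal I := by
      intro i
      have h1 := mem_succExtension.1 hC' (i + 1)
      have h2 := contraction_le_headIdeal I (mem_succExtension.1 hu (i + 1))
      have h3 : (finSuccEquiv K n (u + v * X 0)).coeff (i + 1) =
          (finSuccEquiv K n u).coeff (i + 1) + (finSuccEquiv K n v).coeff i := by
        rw [map_add, map_mul, finSuccEquiv_X_zero, Polynomial.coeff_add, Polynomial.coeff_mul_X]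
      rw [h3] at h1
      exact (Submodule.add_mem_iff_right _ h2).1 h1
    have hv : v ∈ idealC 0 B := by
      rw [idealC_eq_succExtension hBI hB, mem_succExtension]; exact hcoeff
    refine Ideal.add_mem _ ?_ (mul_comm v (X 0) ▸ X_mul_mem_initFormIdeal hBI hsq hv)
    have hle : succExtension (contraction 0 I) ≤ initFormIdeal 0 I := by
      rw [succExtension, Ideal.map_le_iff_le_comap]
      intro q hq
      rw [Ideal.mem_comap]
      have : initForm 0 (rename Fin.succ q) = rename Fin.succ q := by
        rw [initForm, topCoeff_zero_eq, headCoeff_rename_succ, degreeOf_rename_succ, pow_zero,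
          one_mul]
      rw [← this]
      exact Ideal.subset_span ⟨_, mem_contraction_zero.1 hq, rfl⟩
    exact hle hu

/-- The ideals obtained from `I` by iterating the two ideals of the decomposition with respect to
the first variable are equidimensional. -/
def IsHereditarilyEquidimensional : (n : ℕ) → Ideal (MvPolynomial (Fin n) K) → Prop
  | 0, _ => True
  | n + 1, I => IsEquidimensionalQuotient I ∧ IsHereditarilyEquidimensional n (headIdeal I) ∧
      IsHereditarilyEquidimensional n (contraction 0 I)

theorem isGVD_of_hasSquarefreeInitial (n : ℕ) (I : Ideal (MvPolynomial (Fin n) K))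
    (hI : HasSquarefreeInitial MonomialOrder.lex I) (h : IsHereditarilyEquidimensional n I) :
    IsGVD n I := by
  induction n with
  | zero =>
    have hf : IsField (MvPolynomial (Fin 0) K) :=
      (isEmptyAlgEquiv K (Fin 0)).toMulEquiv.isField (Field.toIsField K)
    let _ := hf.toField
    exact Ideal.eq_bot_or_top I
  | succ n ih =>
    obtain ⟨heq, hC, hN⟩ := h
    obtain ⟨B, hB, hBsq, hBdiv⟩ := hI.exists_basis
    have hdeg : ∀ g ∈ B, degreeOf 0 g ≤ 1 := by
      intro g hg
      by_cases hg0 : g = 0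
      · simp [hg0]
      · have := hBsq g hg 0
        rwa [lex_degree_eq_cons hg0, Finsupp.cons_zero] at this
    refine ⟨isUnmixed_of_isRadical hI.isRadical heq, Or.inr ⟨0, MonomialOrder.lex, B,
      isCompatible_lex_zero, hB, initFormIdeal_eq hB.1 hdeg hBdiv, ?_, ?_⟩⟩
    · rw [idealC_eq_succExtension hB.1 hBdiv, contraction_succExtension]
      exact ih _ hI.headIdeal hC
    · rw [idealN_eq_succExtension hB.1 hBdiv, contraction_succExtension]
      exact ih _ hI.contraction hN

end Step

/-! ### Descent of equidimensionality along added variables. -/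

section Equidimensional

variable {K : Type*} [Field K] {n : ℕ}

lemma ringKrullDim_quotient_succExtension (J : Ideal (MvPolynomial (Fin n) K)) :
    ringKrullDim (MvPolynomial (Fin (n + 1)) K ⧸ succExtension J) =
      ringKrullDim (MvPolynomial (Fin n) K ⧸ J) + 1 := by
  rw [← Polynomial.ringKrullDim_of_isNoetherianRing]
  have h : J.map (Polynomial.C : _ →+* Polynomial (MvPolynomial (Fin n) K)) =
      (succExtension J).map (finSuccEquiv K n).toRingEquiv := by
    rw [succExtension_eq_comap]
    exact (Ideal.map_comap_of_surjective _ (finSuccEquiv K n).toRingEquiv.surjective _).symm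
  exact (ringKrullDim_eq_of_ringEquiv
    (Ideal.quotientEquiv _ _ (finSuccEquiv K n).toRingEquiv h)).trans
      (ringKrullDim_eq_of_ringEquiv (Ideal.polynomialQuotientEquivQuotientPolynomial J)).symm

lemma isPrime_succExtension {P : Ideal (MvPolynomial (Fin n) K)} (hP : P.IsPrime) :
    (succExtension P).IsPrime := by
  rw [succExtension_eq_comap]
  have : (P.map (Polynomial.C : _ →+* Polynomial (MvPolynomial (Fin n) K))).IsPrime :=
    Ideal.isPrime_map_C_of_isPrime
  exact Ideal.comap_isPrime _ _

/-- Minimal primes of `J` extend to minimal primes of the extension, and one new variable raises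
both dimensions by one. -/
lemma IsEquidimensionalQuotient.of_succExtension {J : Ideal (MvPolynomial (Fin n) K)}
    (h : IsEquidimensionalQuotient (succExtension J)) : IsEquidimensionalQuotient J := by
  intro P hP
  have hPmin : succExtension P ∈ (succExtension J).minimalPrimes := by
    refine ⟨⟨isPrime_succExtension hP.1.1, Ideal.map_mono hP.1.2⟩, ?_⟩
    rintro Q ⟨hQ, hJQ⟩ hQP
    rw [succExtension, Ideal.map_le_iff_le_comap] at hJQ ⊢
    refine hP.2 ⟨Ideal.comap_isPrime _ _, hJQ⟩ fun q hq => ?_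
    exact rename_succ_mem_succExtension.1 (hQP hq)
  have h1 := h _ hPmin
  rw [ringKrullDim_quotient_succExtension, ringKrullDim_quotient_succExtension] at h1
  -- Adding one can be cancelled even at `⊥` and `⊤`, so no finiteness of dimension is needed.
  have key : ∀ a b : WithBot ℕ∞, a + 1 = b + 1 → a = b := by
    intro a b hab
    induction a with
    | bot =>
      induction b with
      | bot => rfl
      | coe b => simp at hab; exact absurd hab.symm (by exact WithBot.coe_ne_bot)
    | coe a =>
      induction b with
      | bot => simp at hab
      | coe b =>
        have : a + 1 = b + 1 := by exact_mod_cast hab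
        rw [WithTop.add_right_cancel ENat.one_ne_top this]
  exact key _ _ h1

/-- The order embedding of `Fin k` onto the last `k` elements of `Fin n`. -/
def shift {l k n : ℕ} (h : l + k = n) (j : Fin k) : Fin n := ⟨l + j, by omega⟩

lemma shift_injective {l k n : ℕ} (h : l + k = n) : Function.Injective (shift h) := by
  intro i j hij
  have := congrArg Fin.val hij
  simp only [shift] at this
  exact Fin.ext (by omega)

lemma shift_succ {l k n : ℕ} (h : l + (k + 1) = n) (h' : l + 1 + k = n) :
    shift h ∘ Fin.succ = shift h' := by
  funext j
  apply Fin.ext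
  simp only [shift, Function.comp_apply, Fin.val_succ]
  omega

lemma IsEquidimensionalQuotient.of_map_shift {l k n : ℕ} (h : l + k = n)
    {J : Ideal (MvPolynomial (Fin k) K)}
    (hJ : IsEquidimensionalQuotient
      (J.map (rename (shift h) : MvPolynomial (Fin k) K →ₐ[K] MvPolynomial (Fin n) K))) :
    IsEquidimensionalQuotient J := by
  induction l generalizing k with
  | zero =>
    obtain rfl : k = n := by omega
    have : shift h = id := by funext j; apply Fin.ext; simp [shift]
    rw [this, rename_id] at hJ
    rwa [show J.map (AlgHom.id K (MvPolynomial (Fin k) K)) = J from Ideal.map_id J] at hJ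
  | succ l ih =>
    have h' : l + (k + 1) = n := by omega
    refine IsEquidimensionalQuotient.of_succExtension (ih h' ?_)
    have : ((succExtension J).map (rename (shift h') :
        MvPolynomial (Fin (k + 1)) K →ₐ[K] MvPolynomial (Fin n) K)) =
        J.map (rename (shift h) : MvPolynomial (Fin k) K →ₐ[K] MvPolynomial (Fin n) K) := by
      rw [succExtension, Ideal.map_mapₐ]
      congr 1
      ext i
      simp [← shift_succ h' h]
    rwa [this]

end Equidimensional

/-! ### Iterated leading coefficients and eliminations. -/

section BlockLead

variable {K : Type*} [Field K]

lemma mem_of_mem_support_sum_monomial {σ : Type*} {s : Finset (σ →₀ ℕ)} {g : (σ →₀ ℕ) → K}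
    {b : σ →₀ ℕ} (hb : b ∈ (∑ c ∈ s, monomial c (g c)).support) : b ∈ s := by
  classical
  rw [mem_support_iff, coeff_sum] at hb
  obtain ⟨c, hc, hne⟩ := Finset.exists_ne_zero_of_sum_ne_zero hb
  rw [coeff_monomial] at hne
  split_ifs at hne with h
  · exact h ▸ hc
  · exact absurd rfl hne

lemma exists_add_of_support {σ : Type*} {P Q : (σ →₀ ℕ) → Prop} (r : MvPolynomial σ K)
    (h : ∀ b ∈ r.support, P b ∨ Q b) :
    ∃ r₁ r₂ : MvPolynomial σ K, r = r₁ + r₂ ∧ (∀ b ∈ r₁.support, P b) ∧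
      ∀ b ∈ r₂.support, Q b := by
  classical
  refine ⟨∑ c ∈ r.support with P c, monomial c (coeff c r),
    ∑ c ∈ r.support with ¬ P c, monomial c (coeff c r), ?_, ?_, ?_⟩
  · rw [Finset.sum_filter_add_sum_filter_not, ← r.as_sum]
  · intro b hb
    exact (Finset.mem_filter.1 (mem_of_mem_support_sum_monomial hb)).2
  · intro b hb
    have := Finset.mem_filter.1 (mem_of_mem_support_sum_monomial hb)
    exact (h b this.1).resolve_left this.2

lemma exists_eq_monomial_mul_rename {σ τ : Type*} (ι : τ → σ) {P : (τ →₀ ℕ) → Prop}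
    (a : σ →₀ ℕ) (r : MvPolynomial σ K)
    (h : ∀ b ∈ r.support, ∃ c, P c ∧ b = a + c.mapDomain ι) :
    ∃ p : MvPolynomial τ K, r = monomial a 1 * rename ι p ∧ ∀ c ∈ p.support, P c := by
  classical
  have h' : ∀ b : σ →₀ ℕ, ∃ c, b ∈ r.support → P c ∧ b = a + c.mapDomain ι := by
    intro b
    by_cases hb : b ∈ r.support
    · obtain ⟨c, hc⟩ := h b hb
      exact ⟨c, fun _ => hc⟩
    · exact ⟨0, fun h => absurd h hb⟩
  choose γ hγ using h'
  refine ⟨∑ b ∈ r.support, monomial (γ b) (coeff b r), ?_, ?_⟩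
  · conv_lhs => rw [r.as_sum]
    rw [map_sum, Finset.mul_sum]
    refine Finset.sum_congr rfl fun b hb => ?_
    rw [rename_monomial, monomial_mul, one_mul, ← (hγ b hb).2]
  · intro c hc
    rw [mem_support_iff, coeff_sum] at hc
    obtain ⟨b, hb, hne⟩ := Finset.exists_ne_zero_of_sum_ne_zero hc
    rw [coeff_monomial] at hne
    split_ifs at hne with h
    · exact h ▸ (hγ b hb).1
    · exact absurd rfl hne

/-- This form leaves `d` free and allows `q = 0`, so no exact degree has to be tracked when steps
are iterated. -/
lemma mem_headIdeal_iff_exists {n : ℕ} {J : Ideal (MvPolynomial (Fin (n + 1)) K)}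
    {q : MvPolynomial (Fin n) K} :
    q ∈ headIdeal J ↔ ∃ (d : ℕ) (p : MvPolynomial (Fin (n + 1)) K),
      (∀ c ∈ p.support, c 0 < d) ∧ X 0 ^ d * rename Fin.succ q + p ∈ J := by
  rw [mem_headIdeal]
  constructor
  · rintro ⟨f, hf, rfl⟩
    refine ⟨degreeOf 0 f, f - X 0 ^ degreeOf 0 f * rename Fin.succ (headCoeff f), ?_, by simpa⟩
    intro c hc
    have h1 : finSuccEquiv K n (f - X 0 ^ degreeOf 0 f * rename Fin.succ (headCoeff f)) =
        (finSuccEquiv K n f).eraseLead := by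
      rw [map_sub, map_mul, map_pow, finSuccEquiv_X_zero, finSuccEquiv_rename_succ, headCoeff,
        ← natDegree_finSuccEquiv, mul_comm, Polynomial.self_sub_C_mul_X_pow]
    have h2 : c 0 ∈ (finSuccEquiv K n f).eraseLead.support := by
      rw [← h1, mem_support_finSuccEquiv]
      exact ⟨c, hc, rfl⟩
    rw [← natDegree_finSuccEquiv]
    exact Polynomial.lt_natDegree_of_mem_eraseLead_support h2
  · rintro ⟨d, p, hp, hJ⟩
    by_cases hq : q = 0
    · exact ⟨0, J.zero_mem, by simp [hq]⟩
    refine ⟨_, hJ, ?_⟩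
    have hdeg : (finSuccEquiv K n p).degree < d := by
      rw [Polynomial.degree_lt_iff_coeff_zero]
      intro i hi
      by_contra hne
      obtain ⟨c, hc, hci⟩ := mem_support_finSuccEquiv.1 (Polynomial.mem_support_iff.2 hne)
      exact absurd (hp c hc) (hci ▸ hi).not_gt
    rw [headCoeff, map_add, map_mul, map_pow, finSuccEquiv_X_zero, finSuccEquiv_rename_succ,
      mul_comm, Polynomial.leadingCoeff_add_of_degree_lt', Polynomial.leadingCoeff_C_mul_X_pow]
    rwa [Polynomial.degree_C_mul_X_pow _ hq]

variable {l k n : ℕ}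

/-- `b` is lexicographically smaller than `a`, with a first difference among the first `l`
entries. -/
def BlockLT (l : ℕ) (b a : Fin n →₀ ℕ) : Prop :=
  ∃ i : Fin n, (i : ℕ) < l ∧ (∀ j < i, b j = a j) ∧ b i < a i

/-- `f`, a polynomial in the last `k` variables, is the leading coefficient of an element of `I`
with respect to the lexicographically ordered first `l` variables, where the leading monomial
involves only variables in `E`. -/
def IsBlockLead (I : Ideal (MvPolynomial (Fin n) K)) (h : l + k = n) (E : Finset (Fin n))
    (f : MvPolynomial (Fin k) K) : Prop :=
  ∃ (a : Fin n →₀ ℕ) (r : MvPolynomial (Fin n) K), a.support ⊆ E ∧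
    monomial a 1 * rename (shift h) f + r ∈ I ∧ ∀ b ∈ r.support, BlockLT l b a

lemma mapDomain_shift_apply (h : l + k = n) (c : Fin k →₀ ℕ) (j : Fin k) :
    c.mapDomain (shift h) (shift h j) = c j :=
  Finsupp.mapDomain_apply (shift_injective h) _ _

lemma mapDomain_shift_of_lt (h : l + k = n) (c : Fin k →₀ ℕ) {i : Fin n} (hi : (i : ℕ) < l) :
    c.mapDomain (shift h) i = 0 := by
  refine Finsupp.mapDomain_of_notMem_range _ _ ?_
  rintro ⟨j, rfl⟩
  simp [shift] at hi

lemma exists_shift_eq (h : l + k = n) {i : Fin n} (hi : l ≤ i) : ∃ j, shift h j = i :=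
  ⟨⟨i - l, by omega⟩, Fin.ext (by simp [shift]; omega)⟩

/-- The exponent `a` vanishes at position `l`, so no strict drop can occur there: enlarging the
block from `l` to `l + 1` does not change the condition on the remainder. -/
lemma mem_contraction_iff_isBlockLead {I : Ideal (MvPolynomial (Fin n) K)} (h : l + (k + 1) = n)
    (h' : l + 1 + k = n) {E : Finset (Fin n)} (hE : ∀ i ∈ E, (i : ℕ) < l)
    {J : Ideal (MvPolynomial (Fin (k + 1)) K)} (hJ : ∀ f, f ∈ J ↔ IsBlockLead I h E f)
    (q : MvPolynomial (Fin k) K) : q ∈ contraction 0 J ↔ IsBlockLead I h' E q := by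
  rw [mem_contraction_zero, hJ, IsBlockLead, IsBlockLead, rename_rename, shift_succ h h']
  refine exists_congr fun a => exists_congr fun r => and_congr_right fun ha =>
    and_congr_right fun _ => forall₂_congr fun b _ => ?_
  constructor
  · rintro ⟨i, hi, h⟩
    exact ⟨i, by omega, h⟩
  · rintro ⟨i, hi, h1, h2⟩
    have h3 := hE i (ha (Finsupp.mem_support_iff.2 (by omega)))
    exact ⟨i, h3, h1, h2⟩

/-- The power `X 0 ^ d` in front of the head coefficient becomes the entry of `a` at the new
position `l`, which therefore joins `E`. -/
lemma mem_headIdeal_iff_isBlockLead {I : Ideal (MvPolynomial (Fin n) K)} (h : l + (k + 1) = n)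
    (h' : l + 1 + k = n) {E : Finset (Fin n)} (hE : ∀ i ∈ E, (i : ℕ) < l)
    {J : Ideal (MvPolynomial (Fin (k + 1)) K)} (hJ : ∀ f, f ∈ J ↔ IsBlockLead I h E f)
    (q : MvPolynomial (Fin k) K) :
    q ∈ headIdeal J ↔ IsBlockLead I h' (insert (shift h 0) E) q := by
  classical
  have hl : ((shift h 0 : Fin n) : ℕ) = l := by simp [shift]
  have hzero : ∀ {a : Fin n →₀ ℕ}, a.support ⊆ E → ∀ i : Fin n, l ≤ i → a i = 0 := by
    intro a ha i hi
    by_contra hne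
    exact absurd (hE i (ha (Finsupp.mem_support_iff.2 hne))) (by omega)
  have hren : ∀ (a : Fin n →₀ ℕ) (d : ℕ),
      monomial a (1 : K) * rename (shift h) (X 0 ^ d * rename Fin.succ q) =
        monomial (a + Finsupp.single (shift h 0) d) 1 * rename (shift h') q := by
    intro a d
    rw [map_mul, map_pow, rename_X, rename_rename, shift_succ h h', ← mul_assoc,
      X_pow_eq_monomial, monomial_mul, one_mul]
  rw [mem_headIdeal_iff_exists]
  constructor
  · rintro ⟨d, p, hp, hpJ⟩
    obtain ⟨a, r, ha, hI, hr⟩ := (hJ _).1 hpJ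
    refine ⟨a + Finsupp.single (shift h 0) d, monomial a 1 * rename (shift h) p + r, ?_, ?_, ?_⟩
    · refine Finsupp.support_add.trans (Finset.union_subset (ha.trans (Finset.subset_insert _ _)) ?_)
      exact Finsupp.support_single_subset.trans (by simp)
    · rw [← add_assoc, ← hren, ← mul_add, ← map_add]
      exact hI
    · intro b hb
      rcases Finset.mem_union.1 (support_add hb) with hb | hb
      · rw [mem_support_iff, coeff_monomial_mul'] at hb
        split_ifs at hb with hab
        · obtain ⟨c, hc, hcoeff⟩ := coeff_rename_ne_zero _ _ _ (right_ne_zero_of_mul hb)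
          have hb' : b = a + c.mapDomain (shift h) := by
            rw [hc, add_tsub_cancel_of_le hab]
          refine ⟨shift h 0, by omega, fun j hj => ?_, ?_⟩
          · have hj' : (j : ℕ) < l := by rw [← hl]; exact hj
            rw [hb', Finsupp.add_apply, Finsupp.add_apply, mapDomain_shift_of_lt h c hj',
              Finsupp.single_eq_of_ne hj.ne]
          · rw [hb', Finsupp.add_apply, Finsupp.add_apply, mapDomain_shift_apply,
              Finsupp.single_eq_same]
            exact Nat.add_lt_add_left (hp c (mem_support_iff.2 hcoeff)) _
        · exact absurd rfl hb
      · obtain ⟨i, hi, h1, h2⟩ := hr b hb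
        have hne : ∀ j ≤ i, (a + Finsupp.single (shift h 0) d) j = a j := by
          intro j hj
          have hj' : (j : ℕ) ≤ i := hj
          rw [Finsupp.add_apply, Finsupp.single_eq_of_ne, add_zero]
          rintro rfl
          omega
        exact ⟨i, by omega, fun j hj => (h1 j hj).trans (hne j hj.le).symm, by rwa [hne i le_rfl]⟩
  · rintro ⟨a', r, ha', hI, hr⟩
    set a := a'.erase (shift h 0) with ha_def
    set d := a' (shift h 0) with hd_def
    have hsum : a' = a + Finsupp.single (shift h 0) d := (Finsupp.erase_add_single _ _).symm
    have ha : a.support ⊆ E := by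
      intro i hi
      rw [ha_def, Finsupp.support_erase, Finset.mem_erase] at hi
      exact (Finset.mem_insert.1 (ha' hi.2)).resolve_left hi.1
    have haj : ∀ j : Fin n, (j : ℕ) < l → a j = a' j := by
      intro j hj
      rw [ha_def, Finsupp.erase_ne]
      rintro rfl
      omega
    -- The terms of `r` are sorted by where they first differ from `a'`. Those that differ first at
    -- `l` share the factor `e^a` and form the lower part `p`; those that differ earlier form the
    -- remainder for `a`.
    obtain ⟨r₁, r₂, rfl, hr₁, hr₂⟩ := exists_add_of_support
      (P := fun b => ∃ c : Fin (k + 1) →₀ ℕ, c 0 < d ∧ b = a + c.mapDomain (shift h))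
      (Q := fun b => BlockLT l b a) r (by
        intro b hb
        obtain ⟨i, hi, h1, h2⟩ := hr b hb
        rcases Nat.lt_succ_iff_lt_or_eq.1 hi with hi | hi
        · right
          refine ⟨i, hi, fun j hj => ?_, by rwa [haj i hi]⟩
          have hj' : (j : ℕ) < i := hj
          rw [h1 j hj, haj j (by omega)]
        · left
          obtain rfl : i = shift h 0 := Fin.ext (hi.trans hl.symm)
          refine ⟨b.comapDomain (shift h) (shift_injective h).injOn, by simpa using h2, ?_⟩
          ext j
          rw [Finsupp.add_apply]
          rcases lt_or_ge (j : ℕ) l with hj | hj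
          · rw [mapDomain_shift_of_lt h _ hj, haj j hj, add_zero]
            exact h1 j (by rw [Fin.lt_def]; omega)
          · rw [hzero ha j hj, zero_add]
            obtain ⟨j, rfl⟩ := exists_shift_eq h hj
            rw [mapDomain_shift_apply, Finsupp.comapDomain_apply])
    obtain ⟨p, rfl, hp⟩ := exists_eq_monomial_mul_rename (shift h) a r₁ hr₁
    refine ⟨d, p, hp, (hJ _).2 ⟨a, r₂, ha, ?_, hr₂⟩⟩
    rw [map_add, mul_add, hren, ← hsum, add_assoc]
    exact hI

end BlockLead

/-! ### Multidegrees and primitive binomials of the toric ideal. -/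

section ToricBinomials

variable {K : Type*} [Field K] {V : Type*} {G : SimpleGraph V} {n : ℕ} (e : Fin n ≃ G.edgeSet)

/-- The exponent of the monomial `u v` associated with the edge `{u, v}`. -/
def edgeExponent (V : Type*) : Sym2 V → V →₀ ℕ :=
  Sym2.lift ⟨fun u v => Finsupp.single u 1 + Finsupp.single v 1, fun _ _ => add_comm _ _⟩

lemma edgeExponent_mk (u v : V) :
    edgeExponent V s(u, v) = Finsupp.single u 1 + Finsupp.single v 1 := rfl

lemma mul_map_X_eq_monomial (s : Sym2 V) :
    Sym2.mul (s.map (X : V → MvPolynomial V K)) = monomial (edgeExponent V s) 1 := by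
  induction s using Sym2.ind with
  | _ u v => rw [edgeExponent_mk, Sym2.map_mk, Sym2.mul_mk, X, X, monomial_mul, one_mul]

/-- The multidegree of a monomial in the edges: the exponent of its image in `K[V(G)]`. -/
def vertexDegree : (Fin n →₀ ℕ) →ₗ[ℕ] (V →₀ ℕ) :=
  Finsupp.linearCombination ℕ fun i => edgeExponent V (e i)

lemma vertexDegree_single (i : Fin n) :
    vertexDegree e (Finsupp.single i 1) = edgeExponent V (e i) := by
  simp [vertexDegree]

lemma vertexDegree_eq_add {α : Fin n →₀ ℕ} {i : Fin n} (hi : α i ≠ 0) :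
    vertexDegree e α = vertexDegree e (α - Finsupp.single i 1) + edgeExponent V (e i) := by
  rw [← vertexDegree_single, ← map_add, tsub_add_cancel_of_le]
  rw [Finsupp.single_le_iff]
  omega

lemma exists_edge_of_vertexDegree_ne_zero {α : Fin n →₀ ℕ} {u : V} (h : vertexDegree e α u ≠ 0) :
    ∃ i x, α i ≠ 0 ∧ (e i : Sym2 V) = s(x, u) := by
  rw [vertexDegree, Finsupp.linearCombination_apply, Finsupp.sum, Finsupp.finsetSum_apply] at h
  obtain ⟨i, hi, hne⟩ := Finset.exists_ne_zero_of_sum_ne_zero h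
  rw [Finsupp.smul_apply, smul_eq_mul] at hne
  have h2 := right_ne_zero_of_mul hne
  induction hs : (e i : Sym2 V) using Sym2.ind with
  | _ x y =>
    rw [hs, edgeExponent_mk, Finsupp.add_apply] at h2
    by_cases hx : x = u
    · exact ⟨i, y, Finsupp.mem_support_iff.1 hi, by rw [hs, hx, Sym2.eq_swap]⟩
    by_cases hy : y = u
    · exact ⟨i, x, Finsupp.mem_support_iff.1 hi, by rw [hs, hy]⟩
    · rw [Finsupp.single_eq_of_ne' hx, Finsupp.single_eq_of_ne' hy] at h2
      exact absurd rfl h2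

variable (K) in
/-- The homomorphism `K[E(G)] → K[V(G)]` in terms of the labels of the edges. -/
def labelHom : MvPolynomial (Fin n) K →ₐ[K] MvPolynomial V K :=
  aeval fun i => monomial (edgeExponent V (e i)) 1

lemma labelHom_monomial (α : Fin n →₀ ℕ) (c : K) :
    labelHom K e (monomial α c) = monomial (vertexDegree e α) c := by
  rw [labelHom, aeval_monomial, vertexDegree, Finsupp.linearCombination_apply,
    monomial_finsupp_sum_index, algebraMap_eq]
  simp only [monomial_pow, one_pow]

lemma exists_of_mem_support_labelHom {f : MvPolynomial (Fin n) K} {t : V →₀ ℕ}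
    (ht : t ∈ (labelHom K e f).support) : ∃ b ∈ f.support, vertexDegree e b = t := by
  classical
  rw [f.as_sum, map_sum, mem_support_iff, coeff_sum] at ht
  obtain ⟨b, hb, hne⟩ := Finset.exists_ne_zero_of_sum_ne_zero ht
  rw [labelHom_monomial, coeff_monomial] at hne
  split_ifs at hne with h
  · exact ⟨b, hb, h⟩
  · exact absurd rfl hne

lemma labelHom_rename {τ : Type*} {H : SimpleGraph V} (ψ : τ → Fin n) (χ : τ → H.edgeSet)
    (h : ∀ a, (e (ψ a) : Sym2 V) = χ a) (f : MvPolynomial τ K) :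
    labelHom K e (rename ψ f) = edgeHom K H (rename χ f) := by
  rw [labelHom, edgeHom, aeval_rename, aeval_rename]
  congr 2
  funext a
  simp only [Function.comp_apply, h, mul_map_X_eq_monomial]

lemma mem_labelledToricIdeal {f : MvPolynomial (Fin n) K} :
    f ∈ labelledToricIdeal K e ↔ labelHom K e f = 0 := by
  constructor
  · intro hf
    have hle : labelledToricIdeal K e ≤ RingHom.ker (labelHom K e) := by
      rw [labelledToricIdeal, toricIdealOfSubgraph, Ideal.map_le_iff_le_comap]
      intro p hp
      rw [Ideal.mem_comap, RingHom.mem_ker, labelHom_rename e _ id (by simp), rename_id_apply]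
      exact hp
    exact hle hf
  · intro hf
    have h1 : rename (fun a : G.edgeSet => e.symm a) (rename e f) = f := by
      rw [rename_rename]
      simp
    have h2 : rename e f ∈ toricIdeal K G := by
      rw [toricIdeal, RingHom.mem_ker, ← labelHom_rename e id e (by simp), rename_id_apply, hf]
    rw [← h1]
    exact Ideal.mem_map_of_mem _ h2

lemma binomial_mem_labelledToricIdeal {α β : Fin n →₀ ℕ} :
    monomial α (1 : K) - monomial β 1 ∈ labelledToricIdeal K e ↔
      vertexDegree e α = vertexDegree e β := by
  rw [mem_labelledToricIdeal, map_sub, labelHom_monomial, labelHom_monomial, sub_eq_zero,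
    monomial_left_inj one_ne_zero]

/-- A pair of monomials of the same multidegree and with disjoint supports dominates a primitive
binomial that involves a prescribed variable. -/
lemma exists_isPrimitiveBinomial_le {i : Fin n} (α β : Fin n →₀ ℕ)
    (hdisj : ∀ j, α j = 0 ∨ β j = 0) (hdeg : vertexDegree e α = vertexDegree e β)
    (hi : α i ≠ 0) :
    ∃ γ δ, γ ≤ α ∧ δ ≤ β ∧ γ i ≠ 0 ∧ IsPrimitiveBinomial K (labelledToricIdeal K e) γ δ := by
  induction hp : (α, β) using WellFoundedLT.induction generalizing α β with
  | ind p ih =>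
    subst hp
    have hne : ∀ {γ δ : Fin n →₀ ℕ}, γ ≤ α → δ ≤ β → γ i ≠ 0 → γ ≠ δ := by
      rintro γ δ - hδ hγ rfl
      have := (hdisj i).resolve_left hi
      have := hδ i
      omega
    have hbi : β i = 0 := (hdisj i).resolve_left hi
    by_cases hprim : IsPrimitiveBinomial K (labelledToricIdeal K e) α β
    · exact ⟨α, β, le_rfl, le_rfl, hi, hprim⟩
    have hex : ∃ γ δ : Fin n →₀ ℕ, γ ≠ δ ∧ vertexDegree e γ = vertexDegree e δ ∧ γ ≤ α ∧ δ ≤ β ∧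
        ¬ (γ = α ∧ δ = β) := by
      by_contra hcon
      push Not at hcon
      refine hprim ⟨⟨hne le_rfl le_rfl hi, (binomial_mem_labelledToricIdeal e).2 hdeg⟩, ?_⟩
      intro γ δ h1 h2 h3 h4
      exact hcon γ δ h1 ((binomial_mem_labelledToricIdeal e).1 h2) h3 h4
    obtain ⟨γ, δ, hγδ, hd, hγ, hδ, hlt⟩ := hex
    -- A smaller relation that misses `i` is subtracted from `(α, β)`; one that involves `i`
    -- replaces it. Either way the pair gets strictly smaller and keeps `i`.
    by_cases hγi : γ i = 0
    · have hγ' : α - γ ≤ α := tsub_le_self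
      have hδ' : β - δ ≤ β := tsub_le_self
      suffices h : ∃ γ' δ', γ' ≤ α - γ ∧ δ' ≤ β - δ ∧ γ' i ≠ 0 ∧
          IsPrimitiveBinomial K (labelledToricIdeal K e) γ' δ' by
        obtain ⟨γ', δ', h1, h2, h3⟩ := h
        exact ⟨γ', δ', h1.trans hγ', h2.trans hδ', h3⟩
      refine ih (α - γ, β - δ) ?_ (α - γ) (β - δ) ?_ ?_ ?_ rfl
      · refine lt_of_le_of_ne ⟨hγ', hδ'⟩ fun h => hγδ ?_
        rw [Prod.mk.injEq] at h
        have h1 : γ = 0 := by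
          ext j
          have := DFunLike.congr_fun h.1 j
          have := hγ j
          simp only [Finsupp.tsub_apply, Finsupp.zero_apply] at *
          omega
        have h2 : δ = 0 := by
          ext j
          have := DFunLike.congr_fun h.2 j
          have := hδ j
          simp only [Finsupp.tsub_apply, Finsupp.zero_apply] at *
          omega
        rw [h1, h2]
      · intro j
        rcases hdisj j with h | h
        · left; simp [h]
        · right; simp [h]
      · have h1 : vertexDegree e (α - γ) + vertexDegree e γ =
            vertexDegree e (β - δ) + vertexDegree e γ := by
          rw [← map_add, tsub_add_cancel_of_le hγ, hd, ← map_add, tsub_add_cancel_of_le hδ, hdeg]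
        exact add_right_cancel h1
      · simpa [hγi] using hi
    · obtain ⟨γ', δ', h1, h2, h3⟩ := ih (γ, δ) (lt_of_le_of_ne ⟨hγ, hδ⟩ (by simpa using hlt)) γ δ
        (fun j => (hdisj j).imp (fun h => Nat.le_zero.1 ((hγ j).trans h.le))
          fun h => Nat.le_zero.1 ((hδ j).trans h.le)) hd hγi rfl
      exact ⟨γ', δ', h1.trans hγ, h2.trans hδ, h3⟩

end ToricBinomials

/-! ### Primitive binomials come from closed even walks. -/

section AlternatingWalk

variable {K : Type*} [Field K] {V : Type*} {G : SimpleGraph V} {n : ℕ} (e : Fin n ≃ G.edgeSet)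

/-- There is a walk of even length from `u` to `v` such that `γ` counts its edges at even
positions and `δ` those at odd positions. -/
def HasEvenWalk (u v : V) (γ δ : Fin n →₀ ℕ) : Prop :=
  ∃ (w : G.Walk u v) (k : ℕ) (i : Fin (2 * k) → Fin n),
    w.edges = List.ofFn (fun j => (e (i j) : Sym2 V)) ∧
      γ = ∑ j : Fin k, Finsupp.single (i ⟨2 * j, by omega⟩) 1 ∧
      δ = ∑ j : Fin k, Finsupp.single (i ⟨2 * j + 1, by omega⟩) 1

lemma hasEvenWalk_nil (v : V) : HasEvenWalk e v v 0 0 :=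
  ⟨SimpleGraph.Walk.nil, 0, fun j => absurd j.2 (by omega), by simp, by simp, by simp⟩

variable {e}

lemma HasEvenWalk.cons {u v x y : V} {γ δ : Fin n →₀ ℕ} (h : HasEvenWalk e u v γ δ)
    {p q : Fin n} (hp : (e p : Sym2 V) = s(y, x)) (hq : (e q : Sym2 V) = s(x, u)) :
    HasEvenWalk e y v (γ + Finsupp.single p 1) (δ + Finsupp.single q 1) := by
  obtain ⟨w, k, i, hw, rfl, rfl⟩ := h
  have hyx : G.Adj y x := by rw [← SimpleGraph.mem_edgeSet, ← hp]; exact (e p).2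
  have hxu : G.Adj x u := by rw [← SimpleGraph.mem_edgeSet, ← hq]; exact (e q).2
  refine ⟨SimpleGraph.Walk.cons hyx (SimpleGraph.Walk.cons hxu w), k + 1,
    (Fin.cons p (Fin.cons q i) : Fin (2 * k + 1 + 1) → Fin n), ?_, ?_, ?_⟩
  · rw [SimpleGraph.Walk.edges_cons, SimpleGraph.Walk.edges_cons, hw, ← hp, ← hq]
    exact (((List.ofFn_succ (f := fun j : Fin (2 * k + 1 + 1) =>
      (e ((Fin.cons p (Fin.cons q i) : Fin (2 * k + 1 + 1) → Fin n) j) : Sym2 V))).trans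
        (congrArg _ List.ofFn_succ))).symm
  · rw [Fin.sum_univ_succ, add_comm]
    rfl
  · rw [Fin.sum_univ_succ, add_comm]
    rfl

lemma HasEvenWalk.isClosedEvenWalkBinomial {v : V} {γ δ : Fin n →₀ ℕ}
    (h : HasEvenWalk e v v γ δ) :
    IsClosedEvenWalkBinomial K e (monomial γ (1 : K) - monomial δ 1) := by
  obtain ⟨w, k, i, hw, rfl, rfl⟩ := h
  refine ⟨v, w, k, i, hw, ?_⟩
  rw [monomial_sum_one, monomial_sum_one]
  rfl

/-- An even walk using edges at even positions from `α` and at odd positions from `β` can be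
prolonged as long as an edge of `β` at its first vertex is available. -/
lemma HasEvenWalk.extend {u v x : V} {α β γ δ : Fin n →₀ ℕ} (h : HasEvenWalk e u v γ δ)
    (hdeg : vertexDegree e α = vertexDegree e β) (hγ : γ ≤ α) (hδ : δ ≤ β)
    (hv : vertexDegree e γ + Finsupp.single v 1 = vertexDegree e δ + Finsupp.single u 1)
    {q : Fin n} (hq : (β - δ) q ≠ 0) (hqx : (e q : Sym2 V) = s(x, u)) :
    ∃ (p : Fin n) (y : V), γ + Finsupp.single p 1 ≤ α ∧ δ + Finsupp.single q 1 ≤ β ∧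
      vertexDegree e (γ + Finsupp.single p 1) + Finsupp.single v 1 =
        vertexDegree e (δ + Finsupp.single q 1) + Finsupp.single y 1 ∧
      HasEvenWalk e y v (γ + Finsupp.single p 1) (δ + Finsupp.single q 1) := by
  have hα : vertexDegree e (α - γ) + vertexDegree e γ = vertexDegree e α := by
    rw [← map_add, tsub_add_cancel_of_le hγ]
  have hβ : vertexDegree e (β - δ) + vertexDegree e δ = vertexDegree e β := by
    rw [← map_add, tsub_add_cancel_of_le hδ]
  have hβq := vertexDegree_eq_add e hq
  rw [hqx, edgeExponent_mk] at hβq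
  -- By the balance `hv`, the unused part of `α` has at `x` at least the degree of the unused part
  -- of `β` with one end of the edge `q` taken away at `u`. The end of `q` at `x` is still counted.
  have hx : vertexDegree e (α - γ) x ≠ 0 := by
    have h1 := DFunLike.congr_fun hα x
    have h2 := DFunLike.congr_fun hβ x
    have h3 := DFunLike.congr_fun hβq x
    have h4 := DFunLike.congr_fun hv x
    have h5 := DFunLike.congr_fun hdeg x
    simp only [Finsupp.add_apply, Finsupp.single_eq_same] at h1 h2 h3 h4
    omega
  obtain ⟨p, y, hp, hpy⟩ := exists_edge_of_vertexDegree_ne_zero e hx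
  refine ⟨p, y, ?_, ?_, ?_, h.cons hpy hqx⟩
  · rw [← le_tsub_iff_left hγ, Finsupp.single_le_iff]; omega
  · rw [← le_tsub_iff_left hδ, Finsupp.single_le_iff]; omega
  · rw [map_add, map_add, vertexDegree_single, vertexDegree_single, hpy, hqx, edgeExponent_mk,
      edgeExponent_mk, add_right_comm, hv]
    abel

/-- While `u ≠ v`, the balance `hv` leaves an unused edge of `β` at `u`, so the walk can be
prolonged. Each prolongation uses up part of `β`, so it must close. -/
lemma HasEvenWalk.exists_closed {v : V} {α β : Fin n →₀ ℕ}
    (hdeg : vertexDegree e α = vertexDegree e β) {u : V} {γ δ : Fin n →₀ ℕ}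
    (h : HasEvenWalk e u v γ δ) (hγ : γ ≤ α) (hδ : δ ≤ β) (hδ0 : δ ≠ 0)
    (hv : vertexDegree e γ + Finsupp.single v 1 = vertexDegree e δ + Finsupp.single u 1) :
    ∃ γ' δ', γ' ≤ α ∧ δ' ≤ β ∧ δ' ≠ 0 ∧ vertexDegree e γ' = vertexDegree e δ' ∧
      HasEvenWalk e v v γ' δ' := by
  induction hr : β - δ using WellFoundedLT.induction generalizing u γ δ with
  | ind r ih =>
    subst hr
    by_cases huv : u = v
    · subst huv
      exact ⟨γ, δ, hγ, hδ, hδ0, add_right_cancel hv, h⟩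
    have hu : vertexDegree e (β - δ) u ≠ 0 := by
      have hα : vertexDegree e (α - γ) + vertexDegree e γ = vertexDegree e α := by
        rw [← map_add, tsub_add_cancel_of_le hγ]
      have hβ : vertexDegree e (β - δ) + vertexDegree e δ = vertexDegree e β := by
        rw [← map_add, tsub_add_cancel_of_le hδ]
      have h1 := DFunLike.congr_fun hα u
      have h2 := DFunLike.congr_fun hβ u
      have h4 := DFunLike.congr_fun hv u
      have h5 := DFunLike.congr_fun hdeg u
      simp only [Finsupp.add_apply, Finsupp.single_eq_same, Finsupp.single_eq_of_ne huv]
        at h1 h2 h4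
      omega
    obtain ⟨q, x, hq, hqx⟩ := exists_edge_of_vertexDegree_ne_zero e hu
    obtain ⟨p, y, h1, h2, h3, h4⟩ := h.extend hdeg hγ hδ hv hq hqx
    refine ih (β - (δ + Finsupp.single q 1)) ?_ h4 h1 h2 ?_ h3 rfl
    · refine lt_of_le_of_ne (tsub_le_tsub_left le_self_add _) fun heq => ?_
      have := DFunLike.congr_fun heq q
      simp only [Finsupp.tsub_apply, Finsupp.add_apply, Finsupp.single_eq_same] at this hq
      omega
    · intro h0
      have := DFunLike.congr_fun h0 q
      simp at this

/-- An alternating walk drawing on `α` and `β` closes up and yields a binomial of the ideal dividing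
the given one termwise. By primitivity the two coincide. -/
lemma IsPrimitiveBinomial.mem_universalBasis {α β : Fin n →₀ ℕ} {i : Fin n}
    (h : IsPrimitiveBinomial K (labelledToricIdeal K e) α β)
    (hdisj : ∀ j, α j = 0 ∨ β j = 0) (hi : α i ≠ 0) :
    monomial α (1 : K) - monomial β 1 ∈ universalBasis K e := by
  refine ⟨⟨α, β, rfl, h⟩, ?_⟩
  have hdeg := (binomial_mem_labelledToricIdeal e).1 h.1.2
  have hu : ∃ u, vertexDegree e β u ≠ 0 := by
    rw [← hdeg, vertexDegree_eq_add e hi]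
    induction hs : (e i : Sym2 V) using Sym2.ind with
    | _ x y => exact ⟨x, by simp [edgeExponent_mk]⟩
  obtain ⟨v, hv⟩ := hu
  obtain ⟨q, x, hq, hqx⟩ := exists_edge_of_vertexDegree_ne_zero e hv
  obtain ⟨p, y, h1, h2, h3, h4⟩ := (hasEvenWalk_nil e v).extend hdeg zero_le zero_le rfl
    (by simpa using hq) hqx
  obtain ⟨γ, δ, hγ, hδ, hδ0, hγδ, hw⟩ := h4.exists_closed hdeg h1 h2 (by
    intro h0
    have := DFunLike.congr_fun h0 q
    simp at this) h3
  have hne : γ ≠ δ := by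
    rintro rfl
    apply hδ0
    ext j
    rcases hdisj j with hj | hj
    · exact Nat.le_zero.1 (hj ▸ hγ j)
    · exact Nat.le_zero.1 (hj ▸ hδ j)
  obtain ⟨rfl, rfl⟩ := h.2 γ δ hne ((binomial_mem_labelledToricIdeal e).2 hγδ) hγ hδ
  exact hw.isClosedEvenWalkBinomial

end AlternatingWalk

/-! ### Identification of the iterated ideals with `idealEF`. -/

section Identification

variable {K : Type*} [Field K] {V : Type*} {G : SimpleGraph V} {l k n : ℕ} (e : Fin n ≃ G.edgeSet)

open scoped MonomialOrder

lemma leadingTerm_binomial {σ : Type*} {m : MonomialOrder σ} {γ δ : σ →₀ ℕ} (h : δ ≺[m] γ) :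
    m.leadingTerm (monomial γ (1 : K) - monomial δ 1) = monomial γ 1 := by
  classical
  have h' : m.degree (monomial δ (1 : K)) ≺[m] m.degree (monomial γ (1 : K)) := by
    rwa [MonomialOrder.degree_monomial, MonomialOrder.degree_monomial, if_neg one_ne_zero,
      if_neg one_ne_zero]
  rw [MonomialOrder.leadingTerm, MonomialOrder.degree_sub_of_lt h',
    MonomialOrder.leadingCoeff_sub_of_lt h', MonomialOrder.leadingCoeff_monomial,
    MonomialOrder.degree_monomial, if_neg one_ne_zero]

lemma lt_of_leadingTerm_binomial {σ : Type*} {m : MonomialOrder σ} {γ δ : σ →₀ ℕ} (hne : γ ≠ δ)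
    (h : m.leadingTerm (monomial γ (1 : K) - monomial δ 1) = monomial γ 1) : δ ≺[m] γ := by
  classical
  have hdeg := m.degree_leadingTerm (monomial γ (1 : K) - monomial δ 1)
  rw [h, MonomialOrder.degree_monomial, if_neg one_ne_zero] at hdeg
  refine lt_of_le_of_ne ?_ fun heq => hne (m.toSyn.injective heq).symm
  rw [hdeg]
  apply MonomialOrder.le_degree
  rw [mem_support_iff, coeff_sub, coeff_monomial, coeff_monomial, if_neg hne, if_pos rfl]
  simp

/-- Characteristic zero rules out the swap `γ = β`, `δ = α`, which characteristic two would allow.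
-/
lemma binomial_inj [CharZero K] {σ : Type*} {α β γ δ : σ →₀ ℕ} (hne : α ≠ β)
    (h : monomial γ (1 : K) - monomial δ 1 = monomial α 1 - monomial β 1) : γ = α ∧ δ = β := by
  classical
  have hα := congrArg (coeff α) h
  rw [coeff_sub, coeff_sub, coeff_monomial, coeff_monomial, coeff_monomial, coeff_monomial,
    if_pos rfl, if_neg (Ne.symm hne), sub_zero] at hα
  have hγ : γ = α := by
    by_contra hγ
    rw [if_neg hγ, zero_sub] at hα
    split_ifs at hα
    · exact absurd hα (by norm_num)
    · simp at hα
  subst hγ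
  refine ⟨rfl, ?_⟩
  rwa [sub_right_inj, monomial_left_inj one_ne_zero] at h

variable {e} in
/-- A monomial that can be lowered after multiplication by a monomial in the variables of `E`
lies in `M^G_{E,F}`. -/
lemma monomial_mem_monomialIdeal {E F : Finset (Fin n)} (hdisj : Disjoint E F)
    (hEF : E ∪ F = ({i | (i : ℕ) < l} : Finset (Fin n))) {a b c : Fin n →₀ ℕ}
    (ha : a.support ⊆ E) (hc : ∀ i : Fin n, (i : ℕ) < l → c i = 0)
    (hdeg : vertexDegree e (a + c) = vertexDegree e b) (hlt : BlockLT l b a) :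
    monomial c (1 : K) ∈ monomialIdeal K e E F := by
  classical
  obtain ⟨i, hil, hij, hi⟩ := hlt
  have hmem : ∀ j : Fin n, (j : ℕ) < l ↔ j ∈ E ∨ j ∈ F := by
    intro j
    rw [← Finset.mem_union, hEF]
    simp
  have haE : ∀ j, j ∉ E → a j = 0 := fun j hj => by
    by_contra hne
    exact hj (ha (Finsupp.mem_support_iff.2 hne))
  have hcommon : vertexDegree e (a + c - b) = vertexDegree e (b - (a + c)) := by
    have h1 : a + c - b + b = b - (a + c) + (a + c) := by
      ext j
      simp only [Finsupp.add_apply, Finsupp.tsub_apply]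
      omega
    have h2 := congrArg (vertexDegree e) h1
    rw [map_add, map_add, hdeg] at h2
    exact add_right_cancel h2
  have hd : ∀ j, (a + c - b) j = 0 ∨ (b - (a + c)) j = 0 := by
    intro j
    simp only [Finsupp.add_apply, Finsupp.tsub_apply]
    omega
  -- After cancelling the common factor, neither side involves a variable before `i`, and `i`
  -- survives only on the left. Keeping `i` in `γ` thus makes `γ` the leading exponent.
  obtain ⟨γ, δ, hγ, hδ, hγi, hprim⟩ := exists_isPrimitiveBinomial_le (K := K) (i := i) e _ _ hd
    hcommon (by simp only [Finsupp.add_apply, Finsupp.tsub_apply]; omega)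
  have hd' : ∀ j, γ j = 0 ∨ δ j = 0 := fun j =>
    (hd j).imp (fun h => Nat.le_zero.1 ((hγ j).trans h.le))
      fun h => Nat.le_zero.1 ((hδ j).trans h.le)
  have hγle : ∀ j, γ j ≤ a j + c j := fun j => (hγ j).trans (by simp)
  have hiE : i ∈ E := by
    by_contra h
    have := haE i h
    omega
  have hlex : δ ≺[MonomialOrder.lex] γ := by
    refine lex_lt_iff_exists.2 ⟨i, fun j hj => ?_, ?_⟩
    · have hj' : (j : ℕ) < i := hj
      have h1 := hγ j
      have h2 := hδ j
      have h3 := hij j hj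
      have h4 := hc j (by omega)
      simp only [Finsupp.add_apply, Finsupp.tsub_apply] at h1 h2
      omega
    · have := hd' i
      omega
  have hsplit : γ.filter (· ∉ E) + γ.filter (· ∈ E) = γ := by
    rw [add_comm]; exact Finsupp.filter_add_filter_not _ _
  have hle : γ.filter (· ∉ E) ≤ c := by
    intro j
    by_cases hj : j ∈ E
    · rw [Finsupp.filter_apply_neg _ _ (by simpa using hj)]; exact Nat.zero_le _
    · rw [Finsupp.filter_apply_pos (· ∉ E) _ hj]
      have h1 := hγle j
      rw [haE j hj, zero_add] at h1
      exact h1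
  -- The generator is the part of `γ` outside `E`, which divides `c`; the part inside `E` is
  -- nontrivial because it contains `i`.
  have hgen : monomial (γ.filter (· ∉ E)) (1 : K) ∈ monomialIdeal K e E F := by
    refine Ideal.subset_span ⟨γ.filter (· ∉ E), γ.filter (· ∈ E), δ, rfl, ?_⟩
    rw [hsplit]
    refine ⟨hprim.mem_universalBasis hd' hγi, leadingTerm_binomial hlex, ?_, ?_, ?_, ?_⟩
    · intro h0
      have := DFunLike.congr_fun h0 i
      rw [Finsupp.filter_apply_pos _ _ hiE] at this
      exact hγi this
    · intro j hj
      rw [Finsupp.support_filter, Finset.mem_filter] at hj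
      exact hj.2
    · intro j hj
      have h1 := hγle j
      rw [haE j (Finset.disjoint_right.1 hdisj hj), hc j ((hmem j).2 (Or.inr hj))] at h1
      exact Nat.le_zero.1 h1
    · intro j hj
      exact Finsupp.filter_apply_neg _ _ (by simpa using hj)
  have hmul : monomial c (1 : K) =
      monomial (c - γ.filter (· ∉ E)) 1 * monomial (γ.filter (· ∉ E)) 1 := by
    rw [monomial_mul, tsub_add_cancel_of_le hle, mul_one]
  rw [hmul]
  exact Ideal.mul_mem_left _ _ hgen

lemma rename_shift_mem_deletedToricIdeal (h : l + k = n) {f : MvPolynomial (Fin k) K}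
    (hf : labelHom K e (rename (shift h) f) = 0) :
    rename (shift h) f ∈ deletedToricIdeal K e ({i | (i : ℕ) < l} : Finset (Fin n)) := by
  let H := G.deleteEdges
    ((fun i => (e i : Sym2 V)) '' (({i | (i : ℕ) < l} : Finset (Fin n)) : Set (Fin n)))
  have hmem : ∀ j : Fin k, (e (shift h j) : Sym2 V) ∈ H.edgeSet := by
    intro j
    rw [SimpleGraph.edgeSet_deleteEdges]
    refine ⟨(e (shift h j)).2, ?_⟩
    rintro ⟨i, hi, hij⟩
    obtain rfl := e.injective (Subtype.ext hij)
    simp [shift] at hi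
  let χ : Fin k → H.edgeSet := fun j => ⟨e (shift h j), hmem j⟩
  have h1 : rename χ f ∈ toricIdeal K H := by
    rw [toricIdeal, RingHom.mem_ker, ← labelHom_rename e (shift h) χ (fun _ => rfl), hf]
  have h2 := Ideal.mem_map_of_mem (rename (fun a : H.edgeSet =>
    e.symm ⟨a, SimpleGraph.edgeSet_mono (G.deleteEdges_le _) a.2⟩) :
      MvPolynomial H.edgeSet K →ₐ[K] MvPolynomial (Fin n) K) h1
  have hχ : ((fun a : H.edgeSet =>
      e.symm ⟨a, SimpleGraph.edgeSet_mono (G.deleteEdges_le _) a.2⟩) ∘ χ) = shift h := by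
    funext j
    simp [χ]
  rw [rename_rename, hχ] at h2
  exact h2

lemma deletedToricIdeal_le (h : l + k = n) {J : Ideal (MvPolynomial (Fin k) K)}
    (hJ : ∀ f, labelHom K e (rename (shift h) f) = 0 → f ∈ J) :
    deletedToricIdeal K e ({i | (i : ℕ) < l} : Finset (Fin n)) ≤
      J.map (rename (shift h) : MvPolynomial (Fin k) K →ₐ[K] MvPolynomial (Fin n) K) := by
  rw [deletedToricIdeal, toricIdealOfSubgraph, Ideal.map_le_iff_le_comap]
  let H := G.deleteEdges
    ((fun i => (e i : Sym2 V)) '' (({i | (i : ℕ) < l} : Finset (Fin n)) : Set (Fin n)))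
  have hex : ∀ a : H.edgeSet, ∃ j, shift h j =
      e.symm ⟨a, SimpleGraph.edgeSet_mono (G.deleteEdges_le _) a.2⟩ := by
    intro a
    refine exists_shift_eq h ?_
    by_contra hlt
    have ha := (Set.ext_iff.1 (SimpleGraph.edgeSet_deleteEdges _) _).1 a.2
    refine ha.2 ⟨e.symm ⟨a, SimpleGraph.edgeSet_mono (G.deleteEdges_le _) a.2⟩, ?_, by simp⟩
    simpa using hlt
  choose ψ hψ using hex
  intro f hf
  rw [Ideal.mem_comap]
  have heq : rename (fun a : H.edgeSet =>
      e.symm ⟨a, SimpleGraph.edgeSet_mono (G.deleteEdges_le _) a.2⟩) f =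
        rename (shift h) (rename ψ f) := by
    rw [rename_rename]
    congr 2
    funext a
    exact (hψ a).symm
  rw [heq]
  refine Ideal.mem_map_of_mem _ (hJ _ ?_)
  rw [← heq, labelHom_rename e _ id (by simp), rename_id_apply]
  exact hf

variable {E F : Finset (Fin n)}

lemma rename_shift_mem_idealEF (h : l + k = n) (hdisj : Disjoint E F)
    (hEF : E ∪ F = ({i | (i : ℕ) < l} : Finset (Fin n))) {f : MvPolynomial (Fin k) K}
    (hf : IsBlockLead (labelledToricIdeal K e) h E f) : rename (shift h) f ∈ idealEF K e E F := by
  obtain ⟨a, r, ha, hI, hr⟩ := hf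
  rw [mem_labelledToricIdeal] at hI
  -- `P c` says that `e^(a + c)` shares its multidegree with a block-smaller monomial, so that its
  -- image could cancel against the remainder.
  let P : (Fin k →₀ ℕ) → Prop := fun c =>
    ∃ b, vertexDegree e (a + c.mapDomain (shift h)) = vertexDegree e b ∧ BlockLT l b a
  obtain ⟨f₁, f₂, rfl, hf₁, hf₂⟩ := exists_add_of_support f fun c _ => em (P c)
  have h₁ : rename (shift h) f₁ ∈ monomialIdeal K e E F := by
    rw [f₁.as_sum, map_sum]
    refine Ideal.sum_mem _ fun c hc => ?_
    obtain ⟨b, hb, hlt⟩ := hf₁ c hc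
    rw [rename_monomial, ← mul_one (coeff c f₁), ← C_mul_monomial]
    exact Ideal.mul_mem_left _ _ (monomial_mem_monomialIdeal hdisj hEF ha
      (fun i hi => mapDomain_shift_of_lt h c hi) hb hlt)
  have hsupp : ∀ (p : MvPolynomial (Fin k) K) (t : V →₀ ℕ),
      t ∈ (labelHom K e (monomial a 1 * rename (shift h) p)).support →
        ∃ c ∈ p.support, vertexDegree e (a + c.mapDomain (shift h)) = t := by
    intro p t ht
    obtain ⟨b, hb, rfl⟩ := exists_of_mem_support_labelHom e ht
    rw [mem_support_iff, coeff_monomial_mul'] at hb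
    split_ifs at hb with hab
    · obtain ⟨c, hc, hne⟩ := coeff_rename_ne_zero _ _ _ (right_ne_zero_of_mul hb)
      exact ⟨c, mem_support_iff.2 hne, by rw [hc, add_tsub_cancel_of_le hab]⟩
    · exact absurd rfl hb
  -- A multidegree surviving in this image would have to cancel against a term from `f₁` or from
  -- `r`. Either provides a block-smaller monomial of that multidegree, against the choice of `f₂`.
  have h₂ : labelHom K e (monomial a 1 * rename (shift h) f₂) = 0 := by
    by_contra hne
    obtain ⟨t, ht⟩ := support_nonempty.2 hne
    obtain ⟨c, hc, hct⟩ := hsupp f₂ t ht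
    have hsum : labelHom K e (monomial a 1 * rename (shift h) f₂) =
        -(labelHom K e (monomial a 1 * rename (shift h) f₁) + labelHom K e r) := by
      rw [map_add, map_add, mul_add, map_add] at hI
      linear_combination hI
    rw [hsum, support_neg] at ht
    classical
    rcases Finset.mem_union.1 (support_add ht) with ht | ht
    · obtain ⟨c', hc', hct'⟩ := hsupp f₁ t ht
      obtain ⟨b, hb, hlt⟩ := hf₁ c' hc'
      exact hf₂ c hc ⟨b, by rw [hct, ← hct', hb], hlt⟩
    · obtain ⟨b, hb, hbt⟩ := exists_of_mem_support_labelHom e ht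
      exact hf₂ c hc ⟨b, by rw [hct, hbt], hr b hb⟩
  rw [map_mul, labelHom_monomial, mul_eq_zero] at h₂
  rw [map_add, idealEF, hEF]
  exact Ideal.add_mem _ (Ideal.mem_sup_right h₁)
    (Ideal.mem_sup_left (rename_shift_mem_deletedToricIdeal e h (h₂.resolve_left (by simp))))

lemma map_shift_eq_idealEF [CharZero K] (h : l + k = n) (hdisj : Disjoint E F)
    (hEF : E ∪ F = ({i | (i : ℕ) < l} : Finset (Fin n))) {J : Ideal (MvPolynomial (Fin k) K)}
    (hJ : ∀ f, f ∈ J ↔ IsBlockLead (labelledToricIdeal K e) h E f) :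
    J.map (rename (shift h) : MvPolynomial (Fin k) K →ₐ[K] MvPolynomial (Fin n) K) =
      idealEF K e E F := by
  have hmem : ∀ j : Fin n, (j : ℕ) < l ↔ j ∈ E ∨ j ∈ F := by
    intro j
    rw [← Finset.mem_union, hEF]
    simp
  apply le_antisymm
  · rw [Ideal.map_le_iff_le_comap]
    intro f hf
    exact rename_shift_mem_idealEF e h hdisj hEF ((hJ f).1 hf)
  rw [idealEF, hEF, sup_le_iff]
  constructor
  · refine deletedToricIdeal_le e h fun f hf => (hJ f).2 ⟨0, 0, by simp, ?_, by simp⟩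
    rw [mem_labelledToricIdeal, add_zero]
    simpa using hf
  · rw [monomialIdeal, Ideal.span_le]
    rintro _ ⟨μ, lam, π, rfl, ⟨⟨α, β, hαβ, hprim⟩, -⟩, hlead, hlam0, hlam, hF, hE⟩
    obtain ⟨rfl, rfl⟩ := binomial_inj hprim.1.1 hαβ
    have hμ : ∀ i : Fin n, (i : ℕ) < l → μ i = 0 := by
      intro i hi
      rcases (hmem i).1 hi with hi | hi
      · exact hE i hi
      · have := hF i hi
        rw [Finsupp.add_apply] at this
        omega
    have hlam_ge : ∀ i : Fin n, l ≤ i → lam i = 0 := by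
      intro i hi
      by_contra hne
      exact absurd ((hmem i).2 (Or.inl (hlam (Finsupp.mem_support_iff.2 hne)))) (by omega)
    have hμc : (μ.comapDomain (shift h) (shift_injective h).injOn).mapDomain (shift h) = μ := by
      ext i
      rcases lt_or_ge (i : ℕ) l with hi | hi
      · rw [mapDomain_shift_of_lt h _ hi, hμ i hi]
      · obtain ⟨j, rfl⟩ := exists_shift_eq h hi
        rw [mapDomain_shift_apply, Finsupp.comapDomain_apply]
    have hren : rename (shift h)
        (monomial (μ.comapDomain (shift h) (shift_injective h).injOn) (1 : K)) = monomial μ 1 := by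
      rw [rename_monomial, hμc]
    rw [SetLike.mem_coe, ← hren]
    refine Ideal.mem_map_of_mem _ ((hJ _).2 ⟨lam, -monomial π 1, hlam, ?_, ?_⟩)
    · rw [hren, monomial_mul, one_mul, add_comm lam, ← sub_eq_add_neg]
      exact hprim.1.2
    · intro b hb
      rw [support_neg] at hb
      obtain rfl := Finset.mem_singleton.1 (support_monomial_subset hb)
      obtain ⟨i, hij, hi⟩ := lex_lt_iff_exists.1 (lt_of_leadingTerm_binomial hprim.1.1 hlead)
      simp only [Finsupp.add_apply] at hij hi
      by_cases hil : (i : ℕ) < l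
      · refine ⟨i, hil, fun j hj => ?_, ?_⟩
        · have hj' : (j : ℕ) < i := hj
          rw [hij j hj, hμ j (by omega), zero_add]
        · rwa [hμ i hil, zero_add] at hi
      -- If the first difference lay beyond the block, `lam` would divide both monomials. Cancelling
      -- it would give a smaller binomial of the ideal, and primitivity would force `lam = 0`.
      · exfalso
        have hle : lam ≤ b := by
          intro j
          rcases lt_or_ge (j : ℕ) l with hj | hj
          · rw [hij j (by rw [Fin.lt_def]; omega)]; exact Nat.le_add_left _ _
          · rw [hlam_ge j hj]; exact Nat.zero_le _
        have hne : μ ≠ b - lam := by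
          rintro rfl
          apply hprim.1.1
          rw [tsub_add_cancel_of_le hle]
        have hdeg := (binomial_mem_labelledToricIdeal e).1 hprim.1.2
        rw [← tsub_add_cancel_of_le hle, map_add, map_add] at hdeg
        have := (hprim.2 μ (b - lam) hne
          ((binomial_mem_labelledToricIdeal e).2 (add_right_cancel hdeg)) le_self_add
          tsub_le_self).1
        exact hlam0 (by simpa using this)

/-- Induction on the number of remaining variables: `headIdeal` moves the label `l` into `E`, and
`contraction` moves it into `F`. -/
lemma isHereditarilyEquidimensional_of_isBlockLead [CharZero K]
    (hequi : ∀ (ℓ : ℕ) (E F : Finset (Fin n)), ℓ ≤ n → Disjoint E F →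
      E ∪ F = ({i | (i : ℕ) < ℓ} : Finset (Fin n)) → IsEquidimensionalQuotient (idealEF K e E F))
    (h : l + k = n) (hdisj : Disjoint E F)
    (hEF : E ∪ F = ({i | (i : ℕ) < l} : Finset (Fin n))) {J : Ideal (MvPolynomial (Fin k) K)}
    (hJ : ∀ f, f ∈ J ↔ IsBlockLead (labelledToricIdeal K e) h E f) :
    IsHereditarilyEquidimensional k J := by
  induction k generalizing l E F with
  | zero => trivial
  | succ k ih =>
    have h' : l + 1 + k = n := by omega
    have hl : ((shift h 0 : Fin n) : ℕ) = l := by simp [shift]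
    have hmem : ∀ j : Fin n, j ∈ E ∨ j ∈ F ↔ (j : ℕ) < l := by
      intro j
      rw [← Finset.mem_union, hEF]
      simp
    have hE : ∀ i ∈ E, (i : ℕ) < l := fun i hi => (hmem i).1 (Or.inl hi)
    have hF : ∀ i ∈ F, (i : ℕ) < l := fun i hi => (hmem i).1 (Or.inr hi)
    have hins : insert (shift h 0) (E ∪ F) = ({i | (i : ℕ) < l + 1} : Finset (Fin n)) := by
      ext j
      rw [Finset.mem_insert, Finset.mem_union, hmem, Fin.ext_iff, hl]
      simp only [Finset.mem_filter, Finset.mem_univ, true_and]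
      omega
    refine ⟨IsEquidimensionalQuotient.of_map_shift h ?_, ?_, ?_⟩
    · rw [map_shift_eq_idealEF e h hdisj hEF hJ]
      exact hequi l E F (by omega) hdisj hEF
    · refine ih h' (E := insert (shift h 0) E) (F := F) ?_ ?_
        (mem_headIdeal_iff_isBlockLead h h' hE hJ)
      · rw [Finset.disjoint_insert_left]
        exact ⟨fun hm => absurd (hF _ hm) (by omega), hdisj⟩
      · rw [Finset.insert_union, hins]
    · refine ih h' (E := E) (F := insert (shift h 0) F) ?_ ?_
        (mem_contraction_iff_isBlockLead h h' hE hJ)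
      · rw [Finset.disjoint_insert_right]
        exact ⟨fun hm => absurd (hE _ hm) (by omega), hdisj⟩
      · rw [Finset.union_insert, hins]

end Identification
end ToricGraph

end

/-! ### Conclusion. -/

theorem mainTheorem9 {K : Type*} [Field K] [IsAlgClosed K] [CharZero K]
    {V : Type*} [Finite V] (G : SimpleGraph V) (n : ℕ) (e : Fin n ≃ G.edgeSet)
    (hsq : IsSquarefreeMonomialIdeal
      (initialIdeal MonomialOrder.lex (labelledToricIdeal K e)))
    (hequi : ∀ (ℓ : ℕ) (E F : Finset (Fin n)), ℓ ≤ n → Disjoint E F →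
      E ∪ F = ({i | (i : ℕ) < ℓ} : Finset (Fin n)) → IsEquidimensionalQuotient (idealEF K e E F)) :
    IsGVD n (labelledToricIdeal K e) := by
  refine isGVD_of_hasSquarefreeInitial n _ (hasSquarefreeInitial_of_initialIdeal hsq) ?_
  have hshift : shift (Nat.zero_add n) = id := by
    funext j
    exact Fin.ext (Nat.zero_add _)
  -- For `l = 0` the block is empty, so `a = 0`, the remainder has no terms, and `IsBlockLead` is
  -- plain membership in `I_G`.
  refine isHereditarilyEquidimensional_of_isBlockLead e hequi (l := 0) (E := ∅) (F := ∅)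
    (Nat.zero_add n) (Finset.disjoint_empty_left _) (by ext; simp) fun f => ?_
  constructor
  · intro hf
    refine ⟨0, 0, by simp, ?_, by simp⟩
    rw [hshift, rename_id_apply, add_zero, ← C_apply, C_1, one_mul]
    exact hf
  · rintro ⟨a, r, ha, hI, hr⟩
    obtain rfl : a = 0 := by simpa using ha
    obtain rfl : r = 0 := by
      rw [← support_eq_empty, Finset.eq_empty_iff_forall_notMem]
      intro b hb
      obtain ⟨i, hi, -⟩ := hr b hb
      omega
    rwa [hshift, rename_id_apply, add_zero, ← C_apply, C_1, one_mul] at hI
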